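/- Let $\Sigma\in\mathbb R^{d\times d}$ be positive definite, $\sigma>0$, and $\theta\in\mathbb R^d$. There are $m$ agents. For agent $i$ a permutation matrix $\Pi_i=\begin{bmatrix}\Pi_{i+}\\ \Pi_{i-}\end{bmatrix}$ splits the $d$ features into $d_i$ observed and $d-d_i$ missing ones; for $v\in\mathbb R^d$ write $v_{i\pm}=\Pi_{i\pm}v$, and $\Sigma_{i+}=\Pi_{i+}\Sigma\Pi_{i+}^\top$, $\Sigma_{i-}=\Pi_{i-}\Sigma\Pi_{i-}^\top$, $\Sigma_{i\pm}=\Pi_{i+}\Sigma\Pi_{i-}^\top$, $\Sigma_{i\mp}=\Sigma_{i\pm}^\top$. Put $$T_i=\begin{bmatrix}I_{d_i}&\Sigma_{i+}^{-1}\Sigma_{i\pm}\end{bmatrix}\Pi_i,\quad \Gamma_{i-}=\Sigma_{i-}-\Sigma_{i\mp}\Sigma_{i+}^{-1}\Sigma_{i\pm},\quad W_i^{g}=\frac{\Sigma_{i+}}{\theta_{i-}^\top\Gamma_{i-}\theta_{i-}+\sigma^2},\quad C^{g}=\Big(\sum_{i=1}^mT_i^\top W_i^{g}T_i\Big)^{-1},$$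 where $\sum_iT_i^\top W_i^{g}T_i$ is assumed to be invertible. *Observation model.* For fixed matrices $X_{i+}\in\mathbb R^{n\times d_i}$ and a parameter $\vartheta\in\mathbb R^d$, draw for each agent $i$ and each row $x_{i+}$ of $X_{i+}$, all independently, the missing features $x_{i-}\sim\mathsf N(\Sigma_{i\mp}\Sigma_{i+}^{-1}x_{i+},\Gamma_{i-})$ and the noise $\xi\sim\mathsf N(0,\sigma^2)$, and let the corresponding entry of $y_i\in\mathbb R^n$ be $\langle x_{i+},\vartheta_{i+}\rangle+\langle x_{i-},\vartheta_{i-}\rangle+\xi$. Let $P_\vartheta$ be the joint law of the local least squares estimates $\hat\theta_i=(X_{i+}^\top X_{i+})^{-1}X_{i+}^\top y_i$, $i=1,\dots,m$. For $\psi:\mathbb R^d\to\mathbb R^s$ and $u\in\mathbb R^s$ let $$\mathfrak M_{n,c}(\psi,u)=\inf_{\bar\theta}\ \sup_{\|\vartheta-\theta\|_2\le cn^{-1/2}} n\,\mathbb E_{Z\sim P_\vartheta}\big\langle u,\bar\theta(Z)-\psi(\vartheta)\big\rangle^2,$$ the infimum being over all measurable functions $\bar\theta$ of $Z=(\hat\theta_1,\dots,\hat\theta_m)$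 (which may depend on the $X_{i+}$, on $\Sigma$ and on $n$). *Lower bounds.* For all $i$ and $n$ let the $n$ rows of $X_{i+}=X_{i+}^{(n)}$ be drawn i.i.d. from $\mathsf N(0,\Sigma_{i+})$ and then held fixed. Then for every $u\in\mathbb R^d$, with probability $1$, $$\liminf_{c\to\infty}\liminf_{n\to\infty}\mathfrak M_{n,c}(\mathrm{id},u)\ \ge\ u^\top C^{g}u,$$ and for every $i$ and every $u\in\mathbb R^{d_i}$, with probability $1$, $$\liminf_{c\to\infty}\liminf_{n\to\infty}\mathfrak M_{n,c}(T_i,u)\ \ge\ u^\top T_iC^{g}T_i^\top u .$$ *Match with the Collab upper bound.* For each $n$ let each agent $i$ have $n$ samples $y=\langle x,\theta\rangle+\xi$ with $x\sim\mathsf N(0,\Sigma)$ and $\xi\sim\mathsf N(0,\sigma^2)$, all independent, of which it sees $(x_{i+},y)$. Let $\hat\theta_i$ be its least squares estimate, $R_i=\frac1n\|X_{i+}\hat\theta_i-y_i\|_2^2$, $\hat W_i=\Sigma_{i+}/R_i$, and let $\hat\theta^{\mathrm{clb}}$ be a (measurable) minimizer of $\vartheta\mapsto\sum_i(T_i\vartheta-\hat\theta_i)^\top\hat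 W_i(T_i\vartheta-\hat\theta_i)$. Then, in distribution as $n\to\infty$, $\sqrt n(\hat\theta^{\mathrm{clb}}-\theta)\to\mathsf N(0,C^{g})$, and $\sqrt n(T_i\hat\theta^{\mathrm{clb}}-T_i\theta)\to\mathsf N(0,T_iC^{g}T_i^\top)$ for every $i$. -/

import Mathlib

open MeasureTheory ProbabilityTheory Filter Matrix
open scoped ENNReal

/-- The views of `m` agents on `d` features. Agent `i` observes `obs i` features and misses `hid i`
features; the permutation `view i` lists the observed features first and the missing ones second
(it is the permutation matrix `Π_i`, with blocks `Π_{i+}` and `Π_{i-}`). -/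
structure Views (m d : ℕ) where
  obs : Fin m → ℕ
  hid : Fin m → ℕ
  view : (i : Fin m) → Fin (obs i) ⊕ Fin (hid i) ≃ Fin d

/-- The ordinary least squares estimate `(XᵀX)⁻¹Xᵀy`. -/
noncomputable def olsEstimate {n p : ℕ} (X : Matrix (Fin n) (Fin p) ℝ) (y : Fin n → ℝ) :
    EuclideanSpace ℝ (Fin p) :=
  WithLp.toLp 2 ((Xᵀ * X)⁻¹ *ᵥ (Xᵀ *ᵥ y))

/-- The linear map `v ↦ A v` between Euclidean spaces. -/
noncomputable def euclMul {p q : ℕ} (A : Matrix (Fin p) (Fin q) ℝ)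
    (v : EuclideanSpace ℝ (Fin q)) : EuclideanSpace ℝ (Fin p) :=
  WithLp.toLp 2 (A *ᵥ v.ofLp)

namespace Views

variable {m d : ℕ} (V : Views m d)

/-- `v_{i+}`, the observed coordinates of `v`. -/
noncomputable def plus (i : Fin m) (v : EuclideanSpace ℝ (Fin d)) :
    EuclideanSpace ℝ (Fin (V.obs i)) :=
  WithLp.toLp 2 fun a => v (V.view i (Sum.inl a))

/-- `v_{i-}`, the missing coordinates of `v`. -/
noncomputable def minus (i : Fin m) (v : EuclideanSpace ℝ (Fin d)) :
    EuclideanSpace ℝ (Fin (V.hid i)) :=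
  WithLp.toLp 2 fun a => v (V.view i (Sum.inr a))

/-- The observed-observed block `A_{i+}`. -/
def blockPP (i : Fin m) (A : Matrix (Fin d) (Fin d) ℝ) :
    Matrix (Fin (V.obs i)) (Fin (V.obs i)) ℝ :=
  A.submatrix (fun a => V.view i (Sum.inl a)) (fun a => V.view i (Sum.inl a))

/-- The observed-missing block `A_{i±}`. -/
def blockPM (i : Fin m) (A : Matrix (Fin d) (Fin d) ℝ) :
    Matrix (Fin (V.obs i)) (Fin (V.hid i)) ℝ :=
  A.submatrix (fun a => V.view i (Sum.inl a)) (fun a => V.view i (Sum.inr a))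

/-- The missing-observed block `A_{i∓}`. -/
def blockMP (i : Fin m) (A : Matrix (Fin d) (Fin d) ℝ) :
    Matrix (Fin (V.hid i)) (Fin (V.obs i)) ℝ :=
  A.submatrix (fun a => V.view i (Sum.inr a)) (fun a => V.view i (Sum.inl a))

/-- The missing-missing block `A_{i-}`. -/
def blockMM (i : Fin m) (A : Matrix (Fin d) (Fin d) ℝ) :
    Matrix (Fin (V.hid i)) (Fin (V.hid i)) ℝ :=
  A.submatrix (fun a => V.view i (Sum.inr a)) (fun a => V.view i (Sum.inr a))

/-- `T_i = [I, Σ_{i+}⁻¹ Σ_{i±}] Π_i`. -/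
noncomputable def transfer (S : Matrix (Fin d) (Fin d) ℝ) (i : Fin m) :
    Matrix (Fin (V.obs i)) (Fin d) ℝ :=
  (Matrix.fromCols 1 ((V.blockPP i S)⁻¹ * V.blockPM i S)).submatrix id (V.view i).symm

/-- The Schur complement `Γ_{i-} = Σ_{i-} - Σ_{i∓} Σ_{i+}⁻¹ Σ_{i±}`. -/
noncomputable def schur (S : Matrix (Fin d) (Fin d) ℝ) (i : Fin m) :
    Matrix (Fin (V.hid i)) (Fin (V.hid i)) ℝ :=
  V.blockMM i S - V.blockMP i S * (V.blockPP i S)⁻¹ * V.blockPM i S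

/-- The Gaussian weights `W_i^g = Σ_{i+} / (θ_{i-}ᵀ Γ_{i-} θ_{i-} + σ²)`. -/
noncomputable def gaussWeight (S : Matrix (Fin d) (Fin d) ℝ) (σ : ℝ)
    (θ : EuclideanSpace ℝ (Fin d)) (i : Fin m) : Matrix (Fin (V.obs i)) (Fin (V.obs i)) ℝ :=
  ((V.minus i θ).ofLp ⬝ᵥ V.schur S i *ᵥ (V.minus i θ).ofLp + σ ^ 2)⁻¹ • V.blockPP i S

/-- `∑ i, T_iᵀ W_i^g T_i`. -/
noncomputable def precision (S : Matrix (Fin d) (Fin d) ℝ) (σ : ℝ)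
    (θ : EuclideanSpace ℝ (Fin d)) : Matrix (Fin d) (Fin d) ℝ :=
  ∑ i, (V.transfer S i)ᵀ * V.gaussWeight S σ θ i * V.transfer S i

/-- `C^g = (∑ i, T_iᵀ W_i^g T_i)⁻¹`. -/
noncomputable def covG (S : Matrix (Fin d) (Fin d) ℝ) (σ : ℝ)
    (θ : EuclideanSpace ℝ (Fin d)) : Matrix (Fin d) (Fin d) ℝ :=
  (V.precision S σ θ)⁻¹

/-! ### The weak observation model (partially fixed design) -/

/-- Given the observed part `x` of a sample of agent `i`, the joint law of its missing part, which
is `N(Σ_{i∓} Σ_{i+}⁻¹ x, Γ_{i-})`, and of its independent label noise, which is `N(0, σ²)`. -/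
noncomputable def hiddenRowLaw (S : Matrix (Fin d) (Fin d) ℝ) (σ : ℝ) (i : Fin m)
    (x : EuclideanSpace ℝ (Fin (V.obs i))) :
    Measure (EuclideanSpace ℝ (Fin (V.hid i)) × ℝ) :=
  (multivariateGaussian (euclMul (V.blockMP i S * (V.blockPP i S)⁻¹) x) (V.schur S i)).prod
    (gaussianReal 0 (σ ^ 2).toNNReal)

/-- The label vector of agent `i`, with entries `⟨x_{i+}, ϑ_{i+}⟩ + ⟨x_{i-}, ϑ_{i-}⟩ + ξ`. -/
noncomputable def fixedLabels {n : ℕ} (ϑ : EuclideanSpace ℝ (Fin d)) (i : Fin m)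
    (X : Fin n → EuclideanSpace ℝ (Fin (V.obs i)))
    (h : Fin n → EuclideanSpace ℝ (Fin (V.hid i)) × ℝ) : Fin n → ℝ :=
  fun k => inner ℝ (X k) (V.plus i ϑ) + inner ℝ (h k).1 (V.minus i ϑ) + (h k).2

/-- The joint law of the local least squares estimates `(θ̂_1, …, θ̂_m)` under the parameter `ϑ`,
when the observed features are held fixed at the rows `X i k`: all missing parts and all noises
are independent over agents and samples. -/
noncomputable def olsLaw {n : ℕ} (S : Matrix (Fin d) (Fin d) ℝ) (σ : ℝ)
    (X : (i : Fin m) → Fin n → EuclideanSpace ℝ (Fin (V.obs i)))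
    (ϑ : EuclideanSpace ℝ (Fin d)) :
    Measure ((i : Fin m) → EuclideanSpace ℝ (Fin (V.obs i))) :=
  (Measure.pi fun i => Measure.pi fun k => V.hiddenRowLaw S σ i (X i k)).map
    fun h i => olsEstimate (Matrix.of fun k => (X i k).ofLp) (V.fixedLabels ϑ i (X i) (h i))

/-- The local minimax risk for the estimation of `⟨u, ψ ϑ⟩` from the local least squares
estimates, over `‖ϑ - θ‖ ≤ c / √n`, for the fixed observed features `X`. The infimum is over all
measurable functions of `(θ̂_1, …, θ̂_m)`; as it is taken with everything else fixed, these may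
depend on `X`, on `Σ` and on `n` in an arbitrary way. -/
noncomputable def minimaxRisk {n s : ℕ} (S : Matrix (Fin d) (Fin d) ℝ) (σ : ℝ)
    (θ : EuclideanSpace ℝ (Fin d))
    (X : (i : Fin m) → Fin n → EuclideanSpace ℝ (Fin (V.obs i)))
    (ψ : EuclideanSpace ℝ (Fin d) → EuclideanSpace ℝ (Fin s)) (c : ℝ)
    (u : EuclideanSpace ℝ (Fin s)) : ℝ≥0∞ :=
  ⨅ (est : ((i : Fin m) → EuclideanSpace ℝ (Fin (V.obs i))) → EuclideanSpace ℝ (Fin s))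
    (_ : Measurable est),
    ⨆ (ϑ : EuclideanSpace ℝ (Fin d)) (_ : ‖ϑ - θ‖ ≤ c / √(n : ℝ)),
      ∫⁻ z, ENNReal.ofReal (n * inner ℝ u (est z - ψ ϑ) ^ 2) ∂(V.olsLaw S σ X ϑ)

/-- For all `n` and `i`, the `n` rows `X n i k` of the observed design of agent `i` are i.i.d.
`N(0, Σ_{i+})`. Nothing is asked of the joint law over different `n` (the designs may be nested or
not) or over different agents. -/
structure IsGaussianDesign {Ω : Type*} [MeasurableSpace Ω] (S : Matrix (Fin d) (Fin d) ℝ)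
    (X : (n : ℕ) → (i : Fin m) → Fin n → Ω → EuclideanSpace ℝ (Fin (V.obs i)))
    (P : Measure Ω) : Prop where
  law : ∀ n i k, HasLaw (X n i k) (multivariateGaussian 0 (V.blockPP i S)) P
  indep : ∀ n i, iIndepFun (X n i) P

/-! ### The Collab estimator (random design) -/

/-- The local least squares estimate `θ̂_i` from full feature vectors `x i k` and labels `y i k`. -/
noncomputable def localOLS {n : ℕ} (x : Fin m → Fin n → EuclideanSpace ℝ (Fin d))
    (y : Fin m → Fin n → ℝ) (i : Fin m) : EuclideanSpace ℝ (Fin (V.obs i)) :=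
  olsEstimate (Matrix.of fun k => (V.plus i (x i k)).ofLp) (y i)

/-- The mean squared residual `R_i = ‖X_{i+} θ̂_i - y_i‖² / n`. -/
noncomputable def residual {n : ℕ} (x : Fin m → Fin n → EuclideanSpace ℝ (Fin d))
    (y : Fin m → Fin n → ℝ) (i : Fin m) : ℝ :=
  (n : ℝ)⁻¹ * ∑ k, (inner ℝ (V.plus i (x i k)) (V.localOLS x y i) - y i k) ^ 2

/-- The weighted empirical risk `∑ i, ‖T_i ϑ - z_i‖²_{W_i}` at `ϑ`. -/
noncomputable def weightedRisk (S : Matrix (Fin d) (Fin d) ℝ)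
    (W : (i : Fin m) → Matrix (Fin (V.obs i)) (Fin (V.obs i)) ℝ)
    (z : (i : Fin m) → EuclideanSpace ℝ (Fin (V.obs i))) (ϑ : EuclideanSpace ℝ (Fin d)) : ℝ :=
  ∑ i, (euclMul (V.transfer S i) ϑ - z i).ofLp ⬝ᵥ
    W i *ᵥ (euclMul (V.transfer S i) ϑ - z i).ofLp

/-- `ϑ` is a Collab estimate for the data `(x, y)`: it minimizes the weighted empirical risk of the
local least squares estimates, with the weights `Ŵ_i = Σ_{i+} / R_i`. -/
def IsCollab {n : ℕ} (S : Matrix (Fin d) (Fin d) ℝ)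
    (x : Fin m → Fin n → EuclideanSpace ℝ (Fin d)) (y : Fin m → Fin n → ℝ)
    (ϑ : EuclideanSpace ℝ (Fin d)) : Prop :=
  IsMinOn (V.weightedRisk S (fun i => (V.residual x y i)⁻¹ • V.blockPP i S) (V.localOLS x y))
    Set.univ ϑ

end Views

/-- For each `n`, the pairs `(x n i k, ξ n i k)` over agents `i` and samples `k < n` are
independent, with features `N(0, Σ)` and independent noise `N(0, σ²)`. -/
structure IsGaussianData {m d : ℕ} {Ω : Type*} [MeasurableSpace Ω]
    (S : Matrix (Fin d) (Fin d) ℝ) (σ : ℝ)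
    (x : (n : ℕ) → Fin m → Fin n → Ω → EuclideanSpace ℝ (Fin d))
    (ξ : (n : ℕ) → Fin m → Fin n → Ω → ℝ) (P : Measure Ω) : Prop where
  law : ∀ n i k, HasLaw (fun ω => (x n i k ω, ξ n i k ω))
    ((multivariateGaussian 0 S).prod (gaussianReal 0 (σ ^ 2).toNNReal)) P
  indep : ∀ n, iIndepFun (fun (p : Fin m × Fin n) ω => (x n p.1 p.2 ω, ξ n p.1 p.2 ω)) P

/-!
Write the label of agent `i` as `⟨x_{i+}, T_i θ⟩` plus an effective noise that collects the
regression residual of the missing features and `ξ`. This noise is independent of `x_{i+}` and has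
variance `v_i(θ) = θ_{i-}ᵀ Γ_{i-} θ_{i-} + σ²`, so each agent faces a well-specified Gaussian
regression for `T_i θ`, with information `T_iᵀ W_i T_i` per sample.

*Lower bounds.* For a fixed design the local least squares estimates are independent Gaussians with
means `T_i ϑ` and covariances `v_i(ϑ) (X_{i+}ᵀ X_{i+})⁻¹`. On a ball of radius `c n^{-1/2}` the
variances `v_i(ϑ)` agree with `v_i(θ)` up to factors tending to `1`, so the model compares with a
Gaussian shift. A Gaussian prior on the line through `θ` in the least favourable direction `C u`
has an explicit Bayes risk, which tends to `uᵀ C u` as the prior spreads out with `c → ∞`.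

*Upper bound.* The normal equation of the weighted least squares problem writes `√n (θ̂ - θ)` as a
sum over agents of random gains, which converge almost surely to `v_i(θ)⁻¹ C T_iᵀ`, applied to the
local scores `n^{-1/2} X_{i+}ᵀ (noise)`. The resulting linear statistic is `C` applied to a total
score of covariance `C⁻¹`, and the central limit theorem and Slutsky's lemma finish the proof.
-/

section TriangularArrays

variable {Ω : Type*} [MeasurableSpace Ω] {P : Measure Ω}

lemma integrable_pow_of_memLp [IsFiniteMeasure P] {f : Ω → ℝ} {p k : ℕ} (hf : MemLp f p P)
    (hk : k ≤ p) : Integrable (fun ω => f ω ^ k) P := by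
  have hfk : MemLp f (k : ℝ≥0∞) P := hf.mono_exponent (by exact_mod_cast hk)
  exact hfk.integrable_norm_pow'.mono' (hf.aestronglyMeasurable.pow k)
    (Eventually.of_forall fun ω => by simp)

lemma integral_add_pow_four_of_indepFun [IsProbabilityMeasure P] {X Y : Ω → ℝ}
    (hXY : IndepFun X Y P) (hX : MemLp X 4 P) (hY : MemLp Y 4 P)
    (hX0 : ∫ ω, X ω ∂P = 0) (hY0 : ∫ ω, Y ω ∂P = 0) :
    ∫ ω, (X ω + Y ω) ^ 4 ∂P =
      ∫ ω, X ω ^ 4 ∂P + 6 * ((∫ ω, X ω ^ 2 ∂P) * ∫ ω, Y ω ^ 2 ∂P) + ∫ ω, Y ω ^ 4 ∂P := by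
  have integral_mixed (p q : ℕ) :
      ∫ ω, X ω ^ p * Y ω ^ q ∂P = (∫ ω, X ω ^ p ∂P) * ∫ ω, Y ω ^ q ∂P :=
    hXY.integral_fun_comp_mul_comp (f := (· ^ p)) (g := (· ^ q))
      hX.aestronglyMeasurable.aemeasurable hY.aestronglyMeasurable.aemeasurable
      (by fun_prop) (by fun_prop)
  have integrable_mixed (p q : ℕ) (hp : p ≤ 4) (hq : q ≤ 4) :
      Integrable (fun ω => X ω ^ p * Y ω ^ q) P :=
    (hXY.comp (φ := (· ^ p)) (ψ := (· ^ q)) (by fun_prop) (by fun_prop)).integrable_mul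
      (integrable_pow_of_memLp hX hp) (integrable_pow_of_memLp hY hq)
  calc ∫ ω, (X ω + Y ω) ^ 4 ∂P
      = ∫ ω, ∑ k ∈ Finset.range 5, X ω ^ k * Y ω ^ (4 - k) * (Nat.choose 4 k) ∂P := by
        simp only [add_pow]
    _ = ∑ k ∈ Finset.range 5, (∫ ω, X ω ^ k ∂P) * (∫ ω, Y ω ^ (4 - k) ∂P) * Nat.choose 4 k := by
        rw [integral_finsetSum _ fun k hk => (integrable_mixed k (4 - k)
          (Nat.lt_succ_iff.1 (Finset.mem_range.1 hk)) (Nat.sub_le 4 k)).mul_const _]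
        simp only [integral_mul_const, integral_mixed]
    _ = _ := by
        simp [Finset.sum_range_succ, hX0, hY0, Nat.choose]
        ring

lemma integral_sum_sq_of_iIndepFun [IsProbabilityMeasure P] {ι : Type*} {Y : ι → Ω → ℝ}
    (hind : iIndepFun Y P) (hY : ∀ i, MemLp (Y i) 2 P) (hY0 : ∀ i, ∫ ω, Y i ω ∂P = 0)
    (s : Finset ι) :
    ∫ ω, (∑ i ∈ s, Y i ω) ^ 2 ∂P = ∑ i ∈ s, ∫ ω, Y i ω ^ 2 ∂P := by
  have hsum0 : ∫ ω, (∑ i ∈ s, Y i) ω ∂P = 0 := by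
    simp only [Finset.sum_apply]
    rw [integral_finsetSum _ fun i _ => (hY i).integrable one_le_two,
      Finset.sum_eq_zero fun i _ => hY0 i]
  have hvar := IndepFun.variance_sum (s := s) (fun i _ => hY i)
    fun i _ j _ hij => hind.indepFun hij
  rw [variance_of_integral_eq_zero (memLp_finsetSum' s fun i _ => hY i).aemeasurable hsum0] at hvar
  simpa only [Finset.sum_apply,
    variance_of_integral_eq_zero (hY _).aemeasurable (hY0 _)] using hvar

lemma integral_sum_pow_four_le_of_iIndepFun [IsProbabilityMeasure P] {ι : Type*}
    {Y : ι → Ω → ℝ} (hind : iIndepFun Y P) (hY : ∀ i, MemLp (Y i) 4 P)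
    (hY0 : ∀ i, ∫ ω, Y i ω ∂P = 0) {M : ℝ} (hM2 : ∀ i, ∫ ω, Y i ω ^ 2 ∂P ≤ M)
    (hM4 : ∀ i, ∫ ω, Y i ω ^ 4 ∂P ≤ M ^ 2) (s : Finset ι) :
    ∫ ω, (∑ i ∈ s, Y i ω) ^ 4 ∂P ≤ 3 * (s.card * M) ^ 2 := by
  classical
  induction s using Finset.induction with
  | empty => simp
  | insert a s ha ih =>
    have hM0 : 0 ≤ M := (integral_nonneg fun ω => sq_nonneg (Y a ω)).trans (hM2 a)
    have hsum_indep : IndepFun (fun ω => ∑ i ∈ s, Y i ω) (Y a) P := by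
      simpa only [Finset.sum_fn] using
        hind.indepFun_finsetSum_of_notMem₀ (fun i => (hY i).aemeasurable) ha
    have hsum0 : ∫ ω, ∑ i ∈ s, Y i ω ∂P = 0 := by
      rw [integral_finsetSum _ fun i _ => (hY i).integrable (by norm_num),
        Finset.sum_eq_zero fun i _ => hY0 i]
    have hsum2 : ∫ ω, (∑ i ∈ s, Y i ω) ^ 2 ∂P ≤ s.card * M := by
      rw [integral_sum_sq_of_iIndepFun hind (fun i => (hY i).mono_exponent (by norm_num)) hY0]
      simpa using Finset.sum_le_card_nsmul s _ M fun i _ => hM2 i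
    have hadd := integral_add_pow_four_of_indepFun hsum_indep.symm (hY a)
      (memLp_finsetSum s fun i _ => hY i) (hY0 a) hsum0
    have hcross : (∫ ω, Y a ω ^ 2 ∂P) * ∫ ω, (∑ i ∈ s, Y i ω) ^ 2 ∂P ≤ M * (s.card * M) :=
      mul_le_mul (hM2 a) hsum2 (integral_nonneg fun ω => sq_nonneg _) hM0
    simp only [Finset.sum_insert ha, Finset.card_insert_of_notMem ha, hadd, Nat.cast_add,
      Nat.cast_one]
    nlinarith [hM4 a, sq_nonneg M]

lemma ae_tendsto_zero_of_tsum_lintegral_ne_top {f : ℕ → Ω → ℝ≥0∞}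
    (hf : ∀ n, AEMeasurable (f n) P) (hsum : ∑' n, ∫⁻ ω, f n ω ∂P ≠ ∞) :
    ∀ᵐ ω ∂P, Tendsto (fun n => f n ω) atTop (nhds 0) := by
  rw [← lintegral_tsum hf] at hsum
  filter_upwards [ae_lt_top' (AEMeasurable.tsum hf) hsum] with ω hω
  exact ENNReal.tendsto_atTop_zero_of_tsum_ne_top hω.ne

lemma ae_tendsto_zero_of_integral_pow_four_le {f : ℕ → Ω → ℝ} {C : ℝ}
    (hint : ∀ n, Integrable (fun ω => f n ω ^ 4) P) (hf : ∀ n, AEMeasurable (f n) P)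
    (hC : ∀ n : ℕ, ∫ ω, f n ω ^ 4 ∂P ≤ C / (n : ℝ) ^ 2) :
    ∀ᵐ ω ∂P, Tendsto (fun n => f n ω) atTop (nhds 0) := by
  have hsum : ∑' n, ∫⁻ ω, ENNReal.ofReal (f n ω ^ 4) ∂P ≠ ∞ := by
    refine ne_top_of_le_ne_top ((Real.summable_one_div_nat_pow.2 one_lt_two).mul_left
      C).tsum_ofReal_ne_top (ENNReal.tsum_le_tsum fun n => ?_)
    rw [← ofReal_integral_eq_lintegral_ofReal (hint n) (ae_of_all _ fun ω => by positivity)]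
    exact ENNReal.ofReal_le_ofReal ((hC n).trans_eq (by ring))
  filter_upwards [ae_tendsto_zero_of_tsum_lintegral_ne_top
    (fun n => ((hf n).pow_const 4).ennreal_ofReal) hsum] with ω hω
  have hpow : Tendsto (fun n => f n ω ^ 4) atTop (nhds 0) := by
    refine ((ENNReal.tendsto_toReal ENNReal.zero_ne_top).comp hω).congr fun n => ?_
    exact ENNReal.toReal_ofReal (by positivity)
  have hroot : Tendsto (fun n => √√(f n ω ^ 4)) atTop (nhds 0) := by simpa using hpow.sqrt.sqrt
  refine (tendsto_zero_iff_abs_tendsto_zero _).2 (hroot.congr fun n => ?_)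
  rw [show f n ω ^ 4 = (f n ω ^ 2) ^ 2 by ring, Real.sqrt_sq (sq_nonneg _), Real.sqrt_sq_eq_abs,
    Function.comp_apply]

variable {𝓧 : Type*} [MeasurableSpace 𝓧] {ν : Measure 𝓧}

lemma integral_rowSum_pow_four_le [IsProbabilityMeasure P] {n : ℕ} {Z : Fin n → Ω → 𝓧}
    (hlaw : ∀ k, HasLaw (Z k) ν P) (hind : iIndepFun Z P) {f : 𝓧 → ℝ} (hfm : Measurable f)
    (hf : MemLp f 4 ν) (hf0 : ∫ x, f x ∂ν = 0) :
    Integrable (fun ω => (∑ k, f (Z k ω)) ^ 4) P ∧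
    ∫ ω, (∑ k, f (Z k ω)) ^ 4 ∂P ≤
      3 * (n * (1 + ∫ x, f x ^ 2 ∂ν + ∫ x, f x ^ 4 ∂ν)) ^ 2 := by
  have hmoment (k : Fin n) (j : ℕ) : ∫ ω, f (Z k ω) ^ j ∂P = ∫ x, f x ^ j ∂ν :=
    (hlaw k).integral_comp (f := fun x => f x ^ j) (hfm.pow_const j).aestronglyMeasurable
  have h2 : 0 ≤ ∫ x, f x ^ 2 ∂ν := integral_nonneg fun x => sq_nonneg _
  have h4 : 0 ≤ ∫ x, f x ^ 4 ∂ν := integral_nonneg fun x => by positivity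
  have hL (k : Fin n) : MemLp (fun ω => f (Z k ω)) 4 P := by
    rw [← (hlaw k).map_eq] at hf
    exact hf.comp_of_map (hlaw k).aemeasurable
  refine ⟨integrable_pow_of_memLp (memLp_finsetSum _ fun k _ => hL k) le_rfl, ?_⟩
  simpa using integral_sum_pow_four_le_of_iIndepFun (hind.comp (fun _ => f) fun _ => hfm) hL
    (fun k => by simpa [hf0] using hmoment k 1) (fun k => (hmoment k 2).trans_le (by linarith))
    (fun k => (hmoment k 4).trans_le (by nlinarith)) Finset.univ

/-- As nothing is asked of the joint law of different rows, the second moments of the row means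
(of order `1 / n`) would not be enough; the fourth moments (of order `1 / n ^ 2`) are summable. -/
lemma ae_tendsto_rowMean [IsProbabilityMeasure P]
    {Z : (n : ℕ) → Fin n → Ω → 𝓧} (hlaw : ∀ n k, HasLaw (Z n k) ν P)
    (hind : ∀ n, iIndepFun (Z n) P) {f : 𝓧 → ℝ} (hfm : Measurable f) (hf : MemLp f 4 ν) :
    ∀ᵐ ω ∂P, Tendsto (fun n : ℕ => (n : ℝ)⁻¹ * ∑ k, f (Z n k ω)) atTop (nhds (∫ x, f x ∂ν)) := by
  have hν : IsProbabilityMeasure ν := (hlaw 1 0).isProbabilityMeasure_iff.1 ‹_›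
  set g : 𝓧 → ℝ := fun x => f x - ∫ x, f x ∂ν
  have hgm : Measurable g := hfm.sub_const _
  have hg0 : ∫ x, g x ∂ν = 0 := by
    simp [g, integral_sub (hf.integrable (by norm_num)) (integrable_const _)]
  have hrow (n : ℕ) := integral_rowSum_pow_four_le (hlaw n) (hind n) hgm
    (hf.sub (memLp_const _)) hg0
  have hmean0 : ∀ᵐ ω ∂P, Tendsto (fun n : ℕ => (n : ℝ)⁻¹ * ∑ k, g (Z n k ω)) atTop (nhds 0) := by
    refine ae_tendsto_zero_of_integral_pow_four_le
      (C := 3 * (1 + ∫ x, g x ^ 2 ∂ν + ∫ x, g x ^ 4 ∂ν) ^ 2) (fun n => ?_)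
      (fun n => (Finset.aemeasurable_fun_sum _ fun k _ =>
        hgm.comp_aemeasurable (hlaw n k).aemeasurable).const_mul _) fun n => ?_
    · simpa only [mul_pow] using (hrow n).1.const_mul _
    · simp only [mul_pow, integral_const_mul]
      rcases n.eq_zero_or_pos with rfl | hn
      · simp
      · refine (mul_le_mul_of_nonneg_left (hrow n).2 (by positivity)).trans_eq ?_
        field_simp
  filter_upwards [hmean0] with ω hω
  refine ((hω.add_const (∫ x, f x ∂ν)).congr' ?_).trans (by simp)
  filter_upwards [eventually_gt_atTop 0] with n hn
  simp only [g, Finset.sum_sub_distrib, Finset.sum_const, Finset.card_univ, Fintype.card_fin,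
    nsmul_eq_mul]
  field_simp
  ring

end TriangularArrays

section GaussianShift

lemma ofReal_variance_le_lintegral_add_sq {Ω : Type*} [MeasurableSpace Ω] {P : Measure Ω}
    [IsProbabilityMeasure P] {X Y : Ω → ℝ} (hXY : IndepFun X Y P) (hX : MemLp X 2 P)
    (hY : AEStronglyMeasurable Y P) :
    ENNReal.ofReal Var[X; P] ≤ ∫⁻ ω, ENNReal.ofReal ((X ω + Y ω) ^ 2) ∂P := by
  have hXYm : AEStronglyMeasurable (X + Y) P := hX.aestronglyMeasurable.add hY
  by_cases htop : ∫⁻ ω, ENNReal.ofReal ((X ω + Y ω) ^ 2) ∂P = ∞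
  · simp [htop]
  have hsq : Integrable (fun ω => (X ω + Y ω) ^ 2) P :=
    ⟨hXYm.pow 2, (hasFiniteIntegral_iff_ofReal (ae_of_all _ fun ω => sq_nonneg _)).2
      (lt_top_iff_ne_top.2 htop)⟩
  have hYL : MemLp Y 2 P := by simpa using ((memLp_two_iff_integrable_sq hXYm).2 hsq).sub hX
  rw [← ofReal_integral_eq_lintegral_ofReal hsq (ae_of_all _ fun ω => sq_nonneg _)]
  refine ENNReal.ofReal_le_ofReal ?_
  calc Var[X; P] ≤ Var[X + Y; P] := by
        rw [hXY.variance_add hX hYL]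
        exact le_add_of_nonneg_right (variance_nonneg _ _)
    _ ≤ ∫ ω, (X ω + Y ω) ^ 2 ∂P := variance_le_expectation_sq hXYm

lemma covariance_dual_prod {E F : Type*} [NormedAddCommGroup E] [NormedSpace ℝ E]
    [MeasurableSpace E] [NormedAddCommGroup F] [NormedSpace ℝ F] [MeasurableSpace F]
    {μ : Measure E} {ν : Measure F} [IsProbabilityMeasure μ] [IsProbabilityMeasure ν]
    (hμ : MemLp id 2 μ) (hν : MemLp id 2 ν) (L L' : StrongDual ℝ (E × F)) :
    cov[L, L'; μ.prod ν] = cov[L.comp (.inl ℝ E F), L'.comp (.inl ℝ E F); μ] +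
      cov[L.comp (.inr ℝ E F), L'.comp (.inr ℝ E F); ν] := by
  have memLp_inl (K : StrongDual ℝ (E × F)) : MemLp (K.comp (.inl ℝ E F)) 2 μ :=
    ContinuousLinearMap.comp_memLp' _ hμ
  have memLp_inr (K : StrongDual ℝ (E × F)) : MemLp (K.comp (.inr ℝ E F)) 2 ν :=
    ContinuousLinearMap.comp_memLp' _ hν
  have memLp_prod (K : StrongDual ℝ (E × F)) : MemLp K 2 (μ.prod ν) := by
    refine (((memLp_inl K).comp_fst ν).add ((memLp_inr K).comp_snd μ)).ae_eq (ae_of_all _ ?_)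
    exact fun p => K.comp_inl_add_comp_inr p
  have hprod := variance_add (memLp_prod L) (memLp_prod L')
  have hinl := variance_add (memLp_inl L) (memLp_inl L')
  have hinr := variance_add (memLp_inr L) (memLp_inr L')
  have hsum := variance_dual_prod (L := L + L') hμ hν
  rw [ContinuousLinearMap.add_comp, ContinuousLinearMap.add_comp] at hsum
  simp only [← FunLike.coe_add, hsum, variance_dual_prod hμ hν] at hprod hinl hinr
  linarith

section Bayes

variable {E : Type*} [NormedAddCommGroup E] [NormedSpace ℝ E]

/-- The observation `t b + g` in a shift family, as a linear function of the parameter `t` and the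
noise `g`. -/
noncomputable def shiftObservation (b : E) : ℝ × E →L[ℝ] E :=
  (ContinuousLinearMap.fst ℝ ℝ E).smulRight b + ContinuousLinearMap.snd ℝ ℝ E

/-- The error `t - r ℓ(t b + g)` of the shrunk linear estimator `r ℓ` of the parameter `t` of a
shift family with `ℓ b = 1`, as a linear function of `t` and the noise `g`. -/
noncomputable def shrinkageError (ℓ : StrongDual ℝ E) (r : ℝ) : StrongDual ℝ (ℝ × E) :=
  (1 - r) • ContinuousLinearMap.fst ℝ ℝ E - r • ℓ.comp (ContinuousLinearMap.snd ℝ ℝ E)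

variable [MeasurableSpace E] [BorelSpace E] [SecondCountableTopology E] [CompleteSpace E]
  {ν : Measure E} [IsGaussian ν] {b : E} {ℓ : StrongDual ℝ E} {s : ℝ}

lemma covariance_shrinkageError (hcov : ∀ L : StrongDual ℝ E, cov[L, ℓ; ν] = s * L b)
    (τ : NNReal) (r : ℝ) (L : StrongDual ℝ (ℝ × E)) :
    cov[shrinkageError ℓ r, L; (gaussianReal 0 τ).prod ν] =
      (1 - r) * τ * L (1, 0) - r * s * L (0, b) := by
  have hL1 : ⇑(L.comp (.inl ℝ ℝ E)) = fun t => L (1, 0) * t := by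
    ext t
    simpa [mul_comm] using L.map_smul t (1, 0)
  have he1 : ⇑((shrinkageError ℓ r).comp (.inl ℝ ℝ E)) = fun t => (1 - r) * t := by
    ext t; simp [shrinkageError]
  have he2 : ⇑((shrinkageError ℓ r).comp (.inr ℝ ℝ E)) = fun g => -r * ℓ g := by
    ext g; simp [shrinkageError]
  have hid : cov[fun t : ℝ => t, fun t => t; gaussianReal 0 τ] = τ := by
    rw [covariance_self (by fun_prop), variance_fun_id_gaussianReal]
  rw [covariance_dual_prod IsGaussian.memLp_two_id IsGaussian.memLp_two_id, hL1, he1, he2,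
    covariance_const_mul_left, covariance_const_mul_right, covariance_const_mul_left, hid,
    covariance_comm, hcov]
  simp
  ring

lemma indepFun_shrinkageError_shiftObservation
    (hcov : ∀ L : StrongDual ℝ E, cov[L, ℓ; ν] = s * L b) {τ : NNReal} {r : ℝ}
    (hr : (1 - r) * τ = r * s) :
    IndepFun (shrinkageError ℓ r) (shiftObservation b) ((gaussianReal 0 τ).prod ν) := by
  have hjoint : HasGaussianLaw (fun p => (shrinkageError ℓ r p, shiftObservation b p))
      ((gaussianReal 0 τ).prod ν) :=
    IsGaussian.hasGaussianLaw_id.map ((shrinkageError ℓ r).prod (shiftObservation b))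
  refine hjoint.indepFun_of_covariance_strongDual fun L₁ L₂ => ?_
  have hL₁ : L₁ ∘ shrinkageError ℓ r = fun p => L₁ 1 * shrinkageError ℓ r p := by
    ext p
    simpa [mul_comm] using L₁.map_smul (shrinkageError ℓ r p) 1
  rw [hL₁, covariance_const_mul_left, ← ContinuousLinearMap.coe_comp,
    covariance_shrinkageError hcov]
  simp [shiftObservation, hr]

lemma le_bayesRisk_gaussianShift (hb : ℓ b = 1) (hs : 0 < s)
    (hcov : ∀ L : StrongDual ℝ E, cov[L, ℓ; ν] = s * L b) (τ : NNReal)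
    {δ : E → ℝ} (hδ : Measurable δ) (a : ℝ) :
    ENNReal.ofReal (a ^ 2 * (τ * s / (τ + s))) ≤
      ∫⁻ t, ∫⁻ g, ENNReal.ofReal ((δ (t • b + g) - a * t) ^ 2) ∂ν ∂(gaussianReal 0 τ) := by
  set r : ℝ := τ / (τ + s)
  set μ := (gaussianReal 0 τ).prod ν
  have hdenom : (τ : ℝ) + s ≠ 0 := by positivity
  have hbalance : (1 - r) * τ = r * s := by
    simp only [r]
    field_simp
    ring
  have herrL : MemLp (shrinkageError ℓ r) 2 μ := IsGaussian.memLp_dual μ _ 2 (by simp)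
  have hdecomp (p : ℝ × E) : δ (p.1 • b + p.2) - a * p.1 = -a * shrinkageError ℓ r p +
      (δ (shiftObservation b p) - a * r * ℓ (shiftObservation b p)) := by
    simp [shrinkageError, shiftObservation, hb]
    ring
  have hvar : Var[fun p => -a * shrinkageError ℓ r p; μ] = a ^ 2 * (τ * s / (τ + s)) := by
    have he1 : shrinkageError ℓ r (1, 0) = 1 - r := by simp [shrinkageError]
    have heb : shrinkageError ℓ r (0, b) = -r := by simp [shrinkageError, hb]
    rw [variance_const_mul, ← covariance_self herrL.aemeasurable, covariance_shrinkageError hcov,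
      he1, heb, hbalance]
    simp only [r]
    field_simp
    ring
  have hindep := (indepFun_shrinkageError_shiftObservation hcov hbalance).comp
    (measurable_const_mul (-a)) (hδ.sub (ℓ.continuous.measurable.const_mul (a * r)))
  rw [← hvar, lintegral_lintegral (f := fun t g => ENNReal.ofReal ((δ (t • b + g) - a * t) ^ 2))
    (by fun_prop)]
  simp only [hdecomp]
  exact ofReal_variance_le_lintegral_add_sq hindep (herrL.const_mul (-a)) (by fun_prop)

end Bayes

lemma lintegral_projIcc_sub_sq_le (π : Measure ℝ) [IsProbabilityMeasure π] {E : Type*}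
    [MeasurableSpace E] (ν : Measure E) [IsProbabilityMeasure ν] (F : ℝ → E → ℝ) {a r M : ℝ}
    (hr : -r ≤ r) (haM : r = |a| * M) {R : ℝ≥0∞}
    (hR : ∀ t, |t| ≤ M → ∫⁻ g, ENNReal.ofReal ((F t g - a * t) ^ 2) ∂ν ≤ R) :
    ∫⁻ t, ∫⁻ g, ENNReal.ofReal ((Set.projIcc (-r) r hr (F t g) - a * t) ^ 2) ∂ν ∂π ≤
      R + ∫⁻ t in {t | M < |t|}, ENNReal.ofReal (4 * a ^ 2 * t ^ 2) ∂π := by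
  have hms : MeasurableSet {t : ℝ | M < |t|} := measurableSet_lt measurable_const measurable_abs
  rw [← lintegral_add_compl _ hms, add_comm]
  gcongr ?_ + ?_
  · calc _ ≤ ∫⁻ _ in {t : ℝ | M < |t|}ᶜ, R ∂π := by
          refine setLIntegral_mono measurable_const fun t ht => ?_
          have ht' : |t| ≤ M := by simpa using ht
          have hmem : a * t ∈ Set.Icc (-r) r := by
            rw [Set.mem_Icc, ← abs_le, abs_mul, haM]
            gcongr
          refine (lintegral_mono fun g => ENNReal.ofReal_le_ofReal (sq_le_sq.2 ?_)).trans (hR t ht')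
          simpa [Set.projIcc_of_mem hr hmem] using
            Set.abs_projIcc_sub_projIcc (h := hr) (c := F t g) (d := a * t)
      _ ≤ R := by
          rw [setLIntegral_const]
          exact mul_le_of_le_one_right' prob_le_one
  · refine setLIntegral_mono (by fun_prop) fun t ht => ?_
    have hrt : r ≤ |a * t| := by
      rw [abs_mul, haM]
      exact mul_le_mul_of_nonneg_left (le_of_lt ht) (abs_nonneg a)
    calc _ ≤ ∫⁻ _, ENNReal.ofReal ((2 * |a * t|) ^ 2) ∂ν := by
          refine lintegral_mono fun g => ENNReal.ofReal_le_ofReal (sq_le_sq' ?_ ?_)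
          all_goals
            have hproj := Set.mem_Icc.1 (Set.projIcc (-r) r hr (F t g)).2
            linarith [le_abs_self (a * t), neg_abs_le (a * t)]
      _ = ENNReal.ofReal (4 * a ^ 2 * t ^ 2) := by
          simp [mul_pow, ← mul_assoc, show (2 : ℝ) ^ 2 = 4 by norm_num]

lemma le_minimax_gaussianShift {E : Type*} [NormedAddCommGroup E] [NormedSpace ℝ E]
    [MeasurableSpace E] [BorelSpace E] [SecondCountableTopology E] [CompleteSpace E]
    {ν : Measure E} [IsGaussian ν] {b : E} {ℓ : StrongDual ℝ E} (hb : ℓ b = 1) {s : ℝ} (hs : 0 < s)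
    (hcov : ∀ L : StrongDual ℝ E, cov[L, ℓ; ν] = s * L b) (τ : NNReal)
    {δ : E → ℝ} (hδ : Measurable δ) (a : ℝ) {M : ℝ} (hM : 0 ≤ M) {R : ℝ≥0∞}
    (hR : ∀ t : ℝ, |t| ≤ M → ∫⁻ g, ENNReal.ofReal ((δ (t • b + g) - a * t) ^ 2) ∂ν ≤ R) :
    ENNReal.ofReal (a ^ 2 * (τ * s / (τ + s))) ≤
      R + ∫⁻ t in {t | M < |t|}, ENNReal.ofReal (4 * a ^ 2 * t ^ 2) ∂(gaussianReal 0 τ) := by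
  have hr : -(|a| * M) ≤ |a| * M := neg_le_self (by positivity)
  exact (le_bayesRisk_gaussianShift hb hs hcov τ
    (δ := fun z => Set.projIcc _ _ hr (δ z)) (by fun_prop) a).trans
    (lintegral_projIcc_sub_sq_le _ ν (fun t g => δ (t • b + g)) hr rfl hR)

lemma tendsto_setLIntegral_tail_zero {π : Measure ℝ} [IsFiniteMeasure π] {f : ℝ → ℝ≥0∞}
    (hf : ∫⁻ t, f t ∂π ≠ ∞) :
    Tendsto (fun M : ℝ => ∫⁻ t in {t | M < |t|}, f t ∂π) atTop (nhds 0) := by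
  refine tendsto_setLIntegral_zero hf ?_
  have hempty : ⋂ M : ℝ, {t : ℝ | M < |t|} = ∅ :=
    Set.eq_empty_of_forall_notMem fun t ht => lt_irrefl |t| (Set.mem_iInter.1 ht |t|)
  have h := tendsto_measure_iInter_atTop (μ := π) (s := fun M : ℝ => {t : ℝ | M < |t|})
    (fun M => (measurableSet_lt measurable_const measurable_abs).nullMeasurableSet)
    (fun M N hMN t ht => lt_of_le_of_lt hMN ht) ⟨0, measure_ne_top _ _⟩
  rwa [hempty, measure_empty] at h

end GaussianShift

section EuclideanMatrices

variable {p q r : ℕ}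

lemma real_inner_eq_dotProduct (x y : EuclideanSpace ℝ (Fin p)) :
    inner ℝ x y = x.ofLp ⬝ᵥ y.ofLp := by
  rw [EuclideanSpace.inner_eq_star_dotProduct, dotProduct_comm, star_trivial]

lemma euclMul_apply (A : Matrix (Fin p) (Fin q) ℝ) (v : EuclideanSpace ℝ (Fin q)) :
    (euclMul A v).ofLp = A *ᵥ v.ofLp := rfl

lemma inner_euclMul (A : Matrix (Fin p) (Fin q) ℝ) (x : EuclideanSpace ℝ (Fin q))
    (y : EuclideanSpace ℝ (Fin p)) : inner ℝ (euclMul A x) y = inner ℝ x (euclMul Aᵀ y) := by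
  simp only [real_inner_eq_dotProduct, euclMul_apply]
  rw [dotProduct_mulVec, vecMul_transpose]

lemma continuous_euclMul (A : Matrix (Fin p) (Fin q) ℝ) : Continuous (euclMul A) := by
  unfold euclMul
  fun_prop

@[fun_prop]
lemma measurable_euclMul (A : Matrix (Fin p) (Fin q) ℝ) : Measurable (euclMul A) :=
  (continuous_euclMul A).measurable

lemma euclMul_add (A : Matrix (Fin p) (Fin q) ℝ) (x y : EuclideanSpace ℝ (Fin q)) :
    euclMul A (x + y) = euclMul A x + euclMul A y := by
  ext k; simp [euclMul, mulVec_add]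

lemma euclMul_sub (A : Matrix (Fin p) (Fin q) ℝ) (x y : EuclideanSpace ℝ (Fin q)) :
    euclMul A (x - y) = euclMul A x - euclMul A y := by
  ext k; simp [euclMul, mulVec_sub]

lemma euclMul_smul (A : Matrix (Fin p) (Fin q) ℝ) (c : ℝ) (x : EuclideanSpace ℝ (Fin q)) :
    euclMul A (c • x) = c • euclMul A x := by
  ext k; simp [euclMul, mulVec_smul]

lemma smul_euclMul (c : ℝ) (A : Matrix (Fin p) (Fin q) ℝ) (x : EuclideanSpace ℝ (Fin q)) :
    euclMul (c • A) x = c • euclMul A x := by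
  ext k; simp [euclMul, smul_mulVec]

lemma sub_euclMul (A B : Matrix (Fin p) (Fin q) ℝ) (x : EuclideanSpace ℝ (Fin q)) :
    euclMul (A - B) x = euclMul A x - euclMul B x := by
  ext k; simp [euclMul, sub_mulVec]

lemma euclMul_sum {ι : Type*} (s : Finset ι) (A : Matrix (Fin p) (Fin q) ℝ)
    (x : ι → EuclideanSpace ℝ (Fin q)) : euclMul A (∑ i ∈ s, x i) = ∑ i ∈ s, euclMul A (x i) :=
  map_sum (Matrix.toLpLin 2 2 A) x s

lemma sum_euclMul {ι : Type*} (s : Finset ι) (A : ι → Matrix (Fin p) (Fin q) ℝ)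
    (x : EuclideanSpace ℝ (Fin q)) : euclMul (∑ i ∈ s, A i) x = ∑ i ∈ s, euclMul (A i) x := by
  ext k; simp [euclMul, sum_mulVec]

lemma euclMul_euclMul (A : Matrix (Fin p) (Fin q) ℝ) (B : Matrix (Fin q) (Fin r) ℝ)
    (x : EuclideanSpace ℝ (Fin r)) : euclMul A (euclMul B x) = euclMul (A * B) x := by
  ext k; simp [euclMul, mulVec_mulVec]

lemma euclMul_one (x : EuclideanSpace ℝ (Fin p)) :
    euclMul (1 : Matrix (Fin p) (Fin p) ℝ) x = x := by
  ext k; simp [euclMul]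

lemma multivariateGaussian_map_euclMul (A : Matrix (Fin p) (Fin q) ℝ)
    (μ : EuclideanSpace ℝ (Fin q)) {K : Matrix (Fin q) (Fin q) ℝ} (hK : K.PosSemidef) :
    (multivariateGaussian μ K).map (euclMul A) =
      multivariateGaussian (euclMul A μ) (A * K * Aᵀ) := by
  have hAK : (A * K * Aᵀ).PosSemidef := by simpa using hK.mul_mul_conjTranspose_same A
  have := Measure.isProbabilityMeasure_map (μ := multivariateGaussian μ K)
    (measurable_euclMul A).aemeasurable
  refine Measure.ext_of_charFun (funext fun t => ?_)
  have hchar : charFun ((multivariateGaussian μ K).map (euclMul A)) t =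
      charFun (multivariateGaussian μ K) (euclMul Aᵀ t) := by
    rw [charFun_apply, charFun_apply, integral_map (by fun_prop)
      (Measurable.aestronglyMeasurable (by fun_prop))]
    simp only [inner_euclMul]
  rw [hchar, charFun_multivariateGaussian hK, charFun_multivariateGaussian hAK,
    inner_euclMul, transpose_transpose]
  simp only [euclMul_apply]
  rw [← mulVec_mulVec, ← mulVec_mulVec, dotProduct_mulVec _ A, ← mulVec_transpose]

lemma stdGaussian_map_euclMul (A : Matrix (Fin p) (Fin q) ℝ) :
    (stdGaussian (EuclideanSpace ℝ (Fin q))).map (euclMul A) =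
      multivariateGaussian 0 (A * Aᵀ) := by
  have hzero : euclMul A 0 = 0 := by simp [euclMul]
  rw [← multivariateGaussian_zero_one, multivariateGaussian_map_euclMul A 0 .one, hzero,
    Matrix.mul_one]

lemma covariance_dual_multivariateGaussian (μ : EuclideanSpace ℝ (Fin p))
    {K : Matrix (Fin p) (Fin p) ℝ} (hK : K.PosSemidef)
    (L : StrongDual ℝ (EuclideanSpace ℝ (Fin p))) (y : EuclideanSpace ℝ (Fin p)) :
    cov[L, fun x => inner ℝ y x; multivariateGaussian μ K] = L (euclMul K y) := by
  obtain ⟨x, rfl⟩ := (InnerProductSpace.toDual ℝ (EuclideanSpace ℝ (Fin p))).surjective L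
  have hcov := covarianceBilin_apply_eq_cov (μ := multivariateGaussian μ K)
    IsGaussian.memLp_two_id x y
  rw [covarianceBilin_multivariateGaussian hK] at hcov
  rw [InnerProductSpace.toDual_apply_apply, real_inner_eq_dotProduct, euclMul_apply, hcov]
  rfl

lemma multivariateGaussian_map_inner (μ : EuclideanSpace ℝ (Fin p))
    {K : Matrix (Fin p) (Fin p) ℝ} (hK : K.PosSemidef) (w : EuclideanSpace ℝ (Fin p)) :
    (multivariateGaussian μ K).map (fun x => inner ℝ x w) =
      gaussianReal (inner ℝ μ w) (w.ofLp ⬝ᵥ K *ᵥ w.ofLp).toNNReal := by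
  have hL : (fun x => inner ℝ x w) = (innerSL ℝ w : EuclideanSpace ℝ (Fin p) → ℝ) := by
    ext x; simp [real_inner_comm]
  rw [hL, IsGaussian.map_eq_gaussianReal,
    ContinuousLinearMap.integral_comp_id_comm IsGaussian.integrable_id,
    integral_id_multivariateGaussian, ← covariance_self (by fun_prop)]
  congr 2
  · exact real_inner_comm μ w
  · rw [← euclMul_apply, ← real_inner_eq_dotProduct]
    exact covariance_dual_multivariateGaussian μ hK (innerSL ℝ w) w

end EuclideanMatrices

section GaussianComparison

lemma gaussianReal_le_of_var_le {v v' : NNReal} {r : ℝ} (hv' : 0 < v') (hr : 0 < r)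
    (hle : v' ≤ v) (hle' : (v : ℝ) ≤ r ^ 2 * v') :
    ENNReal.ofReal r⁻¹ • gaussianReal 0 v' ≤ gaussianReal 0 v := by
  have hv : 0 < v := hv'.trans_le hle
  rw [gaussianReal_of_var_ne_zero 0 hv.ne', gaussianReal_of_var_ne_zero 0 hv'.ne',
    ← withDensity_smul _ (measurable_gaussianPDF 0 v')]
  refine withDensity_mono (Eventually.of_forall fun x => ?_)
  have hsqrt : √(2 * Real.pi * v) ≤ r * √(2 * Real.pi * v') := by
    rw [← Real.sqrt_sq hr.le, ← Real.sqrt_mul (by positivity)]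
    exact Real.sqrt_le_sqrt (by nlinarith [Real.pi_pos])
  have hexp : -x ^ 2 / (2 * v') ≤ -x ^ 2 / (2 * v) := by
    rw [neg_div, neg_div, neg_le_neg_iff]
    gcongr
  simp only [Pi.smul_apply, smul_eq_mul, gaussianPDF, gaussianPDFReal, sub_zero]
  rw [← ENNReal.ofReal_mul (by positivity), ← mul_assoc, ← mul_inv]
  gcongr

lemma pi_smul_le_pi {ι : Type*} [Fintype ι] {α : ι → Type*} [∀ i, MeasurableSpace (α i)]
    {μ ν : (i : ι) → Measure (α i)} [∀ i, SigmaFinite (ν i)] {c : ι → ℝ≥0∞}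
    (h : ∀ i, c i • ν i ≤ μ i) : (∏ i, c i) • Measure.pi ν ≤ Measure.pi μ := by
  have houter : ((∏ i, c i) • Measure.pi ν).toOuterMeasure ≤
      OuterMeasure.pi fun i => (μ i).toOuterMeasure := by
    refine OuterMeasure.le_pi.2 fun s _ => ?_
    calc ((∏ i, c i) • Measure.pi ν) (Set.univ.pi s) = ∏ i, (c i • ν i) (s i) := by
          rw [Measure.smul_apply, Measure.pi_pi, smul_eq_mul, ← Finset.prod_mul_distrib]
          rfl
      _ ≤ ∏ i, μ i (s i) := Finset.prod_le_prod' fun i _ => h i (s i)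
  refine Measure.le_iff.2 fun s hs => (houter s).trans_eq ?_
  rw [Measure.pi, toMeasure_apply _ _ hs]

lemma stdGaussian_map_add_mul {ι : Type*} [Fintype ι] (c : ι → ℝ) {v : ℝ} (hv : 0 ≤ v) :
    (stdGaussian (EuclideanSpace ℝ ι)).map (fun g k => c k + √v * g k) =
      Measure.pi fun k => gaussianReal (c k) v.toNNReal := by
  have hcoord (k : ι) : (gaussianReal 0 1).map (fun x => c k + √v * x) =
      gaussianReal (c k) v.toNNReal := by
    rw [show (fun x => c k + √v * x) = (c k + ·) ∘ (√v * ·) from rfl,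
      ← Measure.map_map (by fun_prop) (by fun_prop), gaussianReal_map_const_mul,
      gaussianReal_map_const_add]
    congr 1
    · ring
    · ext; simp [Real.sq_sqrt hv, hv]
  simp only [← hcoord]
  rw [← map_pi_eq_stdGaussian, Measure.map_map (by fun_prop) (by fun_prop),
    ← Measure.pi_map_pi (by fun_prop)]
  rfl

lemma stdGaussian_map_smul_le {ι : Type*} [Fintype ι] {v v' r : ℝ} (hv' : 0 < v') (hr : 0 < r)
    (hle : v' ≤ v) (hle' : v ≤ r ^ 2 * v') :
    ENNReal.ofReal r⁻¹ ^ Fintype.card ι •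
        (stdGaussian (EuclideanSpace ℝ ι)).map (fun g => √v' • g) ≤
      (stdGaussian (EuclideanSpace ℝ ι)).map (fun g => √v • g) := by
  have hmap {w : ℝ} (hw : 0 ≤ w) : (stdGaussian (EuclideanSpace ℝ ι)).map (fun g => √w • g) =
      (Measure.pi fun _ : ι => gaussianReal 0 w.toNNReal).map (WithLp.toLp 2) := by
    rw [← stdGaussian_map_add_mul (fun _ => 0) hw, Measure.map_map (by fun_prop) (by fun_prop)]
    congr 1
    ext g k
    simp
  have hv : 0 ≤ v := hv'.le.trans hle
  rw [hmap hv'.le, hmap hv, ← Measure.map_smul]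
  refine Measure.map_mono ?_ (by fun_prop)
  rw [← Finset.card_univ, ← Finset.prod_const]
  refine pi_smul_le_pi fun _ => gaussianReal_le_of_var_le (Real.toNNReal_pos.2 hv') hr
    (Real.toNNReal_le_toNNReal hle) ?_
  rwa [Real.coe_toNNReal _ hv, Real.coe_toNNReal _ hv'.le]

open scoped MatrixOrder in
lemma multivariateGaussian_smul_eq_map {p : ℕ} {K : Matrix (Fin p) (Fin p) ℝ} (hK : K.PosSemidef)
    {v : ℝ} (hv : 0 ≤ v) :
    multivariateGaussian 0 (v • K) = ((stdGaussian (EuclideanSpace ℝ (Fin p))).map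
      (fun g => √v • g)).map (euclMul (CFC.sqrt K)) := by
  have hsmul : (fun g : EuclideanSpace ℝ (Fin p) => √v • g) = euclMul (√v • 1) := by
    ext g k; simp [euclMul, smul_mulVec]
  have hsymm : (CFC.sqrt K)ᵀ = CFC.sqrt K := (CFC.sqrt_nonneg K).isSelfAdjoint
  have hcomp : euclMul (CFC.sqrt K) ∘ euclMul (√v • 1) = euclMul (√v • CFC.sqrt K) := by
    ext1 g
    rw [Function.comp_apply, euclMul_euclMul, Matrix.mul_smul, Matrix.mul_one]
  rw [hsmul, Measure.map_map (by fun_prop) (by fun_prop), hcomp, stdGaussian_map_euclMul,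
    transpose_smul, hsymm, Matrix.smul_mul, Matrix.mul_smul, smul_smul, Real.mul_self_sqrt hv,
    CFC.sqrt_mul_sqrt_self K hK.nonneg]

open scoped MatrixOrder in
lemma multivariateGaussian_smul_le {p : ℕ} {K : Matrix (Fin p) (Fin p) ℝ} (hK : K.PosSemidef)
    {v v' r : ℝ} (hv' : 0 < v') (hr : 0 < r) (hle : v' ≤ v) (hle' : v ≤ r ^ 2 * v') :
    ENNReal.ofReal r⁻¹ ^ p • multivariateGaussian 0 (v' • K) ≤
      multivariateGaussian 0 (v • K) := by
  rw [multivariateGaussian_smul_eq_map hK hv'.le,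
    multivariateGaussian_smul_eq_map hK (hv'.le.trans hle), ← Measure.map_smul]
  refine Measure.map_mono ?_ (by fun_prop)
  simpa using stdGaussian_map_smul_le (ι := Fin p) hv' hr hle hle'

end GaussianComparison

section ProductGaussian

variable {ι : Type*} [Fintype ι] {E : ι → Type*} [∀ i, NormedAddCommGroup (E i)]
  [∀ i, NormedSpace ℝ (E i)] [∀ i, MeasurableSpace (E i)]

instance isGaussian_pi [∀ i, BorelSpace (E i)] [∀ i, SecondCountableTopology (E i)]
    [∀ i, CompleteSpace (E i)] (μ : (i : ι) → Measure (E i)) [∀ i, IsGaussian (μ i)] :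
    IsGaussian (Measure.pi μ) := by
  have heval (i : ι) : HasGaussianLaw (fun z : (i : ι) → E i => z i) (Measure.pi μ) :=
    ⟨by rw [(measurePreserving_eval μ i).map_eq]; infer_instance⟩
  have hjoint := iIndepFun.hasGaussianLaw heval
    (iIndepFun_pi (X := fun _ => id) fun _ => aemeasurable_id)
  simpa using hjoint.isGaussian_map

lemma variance_dual_pi [DecidableEq ι] {μ : (i : ι) → Measure (E i)}
    [∀ i, IsProbabilityMeasure (μ i)] (hμ : ∀ i, MemLp id 2 (μ i))
    (L : StrongDual ℝ ((i : ι) → E i)) :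
    Var[L; Measure.pi μ] = ∑ i, Var[L.comp (.single ℝ E i); μ i] := by
  rw [← variance_sum_pi (X := fun i => L.comp (.single ℝ E i))
    fun i => ContinuousLinearMap.comp_memLp' _ (hμ i)]
  congr 1
  ext z
  conv_lhs => rw [← Finset.univ_sum_single z, map_sum]
  simp

lemma covariance_dual_pi [DecidableEq ι] {μ : (i : ι) → Measure (E i)}
    [∀ i, IsProbabilityMeasure (μ i)] (hμ : ∀ i, MemLp id 2 (μ i))
    (L L' : StrongDual ℝ ((i : ι) → E i)) :
    cov[L, L'; Measure.pi μ] =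
      ∑ i, cov[L.comp (.single ℝ E i), L'.comp (.single ℝ E i); μ i] := by
  have memLp_single (i : ι) (K : StrongDual ℝ ((i : ι) → E i)) :
      MemLp (K.comp (.single ℝ E i)) 2 (μ i) := ContinuousLinearMap.comp_memLp' _ (hμ i)
  have memLp_pi (K : StrongDual ℝ ((i : ι) → E i)) : MemLp K 2 (Measure.pi μ) := by
    refine (memLp_finsetSum' Finset.univ fun i _ => (memLp_single i K).comp_measurePreserving
      (measurePreserving_eval μ i)).ae_eq (ae_of_all _ fun z => ?_)
    conv_rhs => rw [← Finset.univ_sum_single z, map_sum]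
    simp
  have hsingle (i : ι) := variance_add (memLp_single i L) (memLp_single i L')
  have hpi := variance_add (memLp_pi L) (memLp_pi L')
  have hsum := variance_dual_pi hμ (L + L')
  simp only [ContinuousLinearMap.add_comp, FunLike.coe_add, hsingle, Finset.sum_add_distrib,
    ← Finset.mul_sum] at hsum
  rw [hsum, variance_dual_pi hμ L, variance_dual_pi hμ L'] at hpi
  linarith

lemma exists_efficient_functional {p : ι → ℕ} {K : (i : ι) → Matrix (Fin (p i)) (Fin (p i)) ℝ}
    (hK : ∀ i, (K i).PosDef) (b : (i : ι) → EuclideanSpace ℝ (Fin (p i)))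
    (hb : ∑ i, inner ℝ (b i) (euclMul (K i)⁻¹ (b i)) ≠ 0) :
    ∃ ℓ : StrongDual ℝ ((i : ι) → EuclideanSpace ℝ (Fin (p i))), ℓ b = 1 ∧
      ∀ L : StrongDual ℝ ((i : ι) → EuclideanSpace ℝ (Fin (p i))),
        cov[L, ℓ; Measure.pi fun i => multivariateGaussian 0 (K i)] =
          (∑ i, inner ℝ (b i) (euclMul (K i)⁻¹ (b i)))⁻¹ * L b := by
  classical
  set info := ∑ i, inner ℝ (b i) (euclMul (K i)⁻¹ (b i))
  set score : StrongDual ℝ ((i : ι) → EuclideanSpace ℝ (Fin (p i))) :=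
    ∑ i, (innerSL ℝ (euclMul (K i)⁻¹ (b i))).comp (.proj i) with hscore
  have hscore_single (i : ι) : score.comp (.single ℝ (fun i => EuclideanSpace ℝ (Fin (p i))) i) =
      innerSL ℝ (euclMul (K i)⁻¹ (b i)) := by
    ext x
    rw [hscore, ContinuousLinearMap.comp_apply, FunLike.coe_sum, Finset.sum_apply,
      Finset.sum_eq_single_of_mem i (Finset.mem_univ i)]
    · simp
    · intro j _ hj
      simp [Pi.single_eq_of_ne hj]
  have hcov (L : StrongDual ℝ ((i : ι) → EuclideanSpace ℝ (Fin (p i)))) :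
      cov[L, score; Measure.pi fun i => multivariateGaussian 0 (K i)] = L b := by
    have hcoord (i : ι) : cov[L.comp (.single ℝ (fun i => EuclideanSpace ℝ (Fin (p i))) i),
        score.comp (.single ℝ (fun i => EuclideanSpace ℝ (Fin (p i))) i);
        multivariateGaussian 0 (K i)] = L (Pi.single i (b i)) := by
      have hdet : IsUnit (K i).det := (hK i).det_pos.ne'.isUnit
      have hcancel := covariance_dual_multivariateGaussian 0 (hK i).posSemidef
        (L.comp (.single ℝ (fun i => EuclideanSpace ℝ (Fin (p i))) i)) (euclMul (K i)⁻¹ (b i))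
      rw [euclMul_euclMul, mul_nonsing_inv _ hdet, euclMul_one] at hcancel
      rw [hscore_single]
      exact hcancel
    rw [covariance_dual_pi fun i => IsGaussian.memLp_two_id, Finset.sum_congr rfl fun i _ =>
      hcoord i, ← map_sum, Finset.univ_sum_single]
  refine ⟨info⁻¹ • score, ?_, fun L => ?_⟩
  · have hscore_b : score b = info := by simp [hscore, info, real_inner_comm]
    simp [hscore_b, hb]
  · rw [← hcov L]
    exact covariance_const_mul_right _

end ProductGaussian

section LeastSquares

variable {n p : ℕ} (X : Fin n → EuclideanSpace ℝ (Fin p))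

/-- The design matrix with rows `X k`. -/
abbrev designMatrix : Matrix (Fin n) (Fin p) ℝ := Matrix.of fun k => (X k).ofLp

/-- The (unnormalized) Gram matrix `∑ₖ xₖ xₖᵀ` of a design with rows `X k`. -/
abbrev designGram : Matrix (Fin p) (Fin p) ℝ := (designMatrix X)ᵀ * designMatrix X

lemma designGram_posSemidef : (designGram X).PosSemidef := by
  simpa using posSemidef_conjTranspose_mul_self (designMatrix X)

lemma euclMul_transpose_designMatrix (e : Fin n → ℝ) :
    euclMul (designMatrix X)ᵀ (WithLp.toLp 2 e) = ∑ k, e k • X k := by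
  ext a
  simp [euclMul, mulVec, dotProduct, mul_comm]

lemma measurable_olsEstimate (A : Matrix (Fin n) (Fin p) ℝ) : Measurable (olsEstimate A) := by
  unfold olsEstimate
  fun_prop

variable {X}

lemma olsEstimate_inner_add (hX : (designGram X).PosDef) (β : EuclideanSpace ℝ (Fin p))
    (e : Fin n → ℝ) :
    olsEstimate (designMatrix X) (fun k => inner ℝ (X k) β + e k) =
      β + euclMul (designGram X)⁻¹ (∑ k, e k • X k) := by
  have hlabels : WithLp.toLp 2 (fun k => inner ℝ (X k) β + e k) =
      euclMul (designMatrix X) β + WithLp.toLp 2 e := by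
    ext k
    simp [real_inner_eq_dotProduct, euclMul, mulVec]
  calc olsEstimate (designMatrix X) (fun k => inner ℝ (X k) β + e k)
      = euclMul (designGram X)⁻¹ (euclMul (designMatrix X)ᵀ
          (WithLp.toLp 2 fun k => inner ℝ (X k) β + e k)) := rfl
    _ = β + euclMul (designGram X)⁻¹ (∑ k, e k • X k) := by
      rw [hlabels, euclMul_add, euclMul_add, euclMul_euclMul _ (designMatrix X),
        euclMul_transpose_designMatrix, euclMul_euclMul, nonsing_inv_mul _ hX.det_pos.ne'.isUnit,
        euclMul_one]

lemma map_olsEstimate_pi_gaussianReal (hX : (designGram X).PosDef)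
    (β : EuclideanSpace ℝ (Fin p)) {v : ℝ} (hv : 0 ≤ v) :
    (Measure.pi fun k => gaussianReal (inner ℝ (X k) β) v.toNNReal).map
        (olsEstimate (designMatrix X)) =
      (multivariateGaussian 0 (v • (designGram X)⁻¹)).map (β + ·) := by
  set A : Matrix (Fin p) (Fin n) ℝ := √v • ((designGram X)⁻¹ * (designMatrix X)ᵀ) with hA
  have hAA : A * Aᵀ = v • (designGram X)⁻¹ := by
    rw [hA, transpose_smul, Matrix.smul_mul, Matrix.mul_smul, smul_smul, Real.mul_self_sqrt hv,
      transpose_mul, transpose_transpose, transpose_nonsing_inv, transpose_mul,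
      transpose_transpose, Matrix.mul_assoc, ← Matrix.mul_assoc (designMatrix X)ᵀ,
      mul_nonsing_inv _ hX.det_pos.ne'.isUnit, Matrix.mul_one]
  have hols : olsEstimate (designMatrix X) ∘ (fun g k => inner ℝ (X k) β + √v * g k) =
      (β + ·) ∘ euclMul A := by
    ext1 g
    have hscore : ∑ k, (√v * g k) • X k = √v • euclMul (designMatrix X)ᵀ g := by
      rw [← euclMul_smul]
      exact (euclMul_transpose_designMatrix X fun k => √v * g k).symm
    rw [Function.comp_apply, Function.comp_apply, olsEstimate_inner_add hX β fun k => √v * g k,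
      hscore, hA, smul_euclMul, ← euclMul_euclMul, euclMul_smul]
  rw [← stdGaussian_map_add_mul _ hv,
    Measure.map_map (measurable_olsEstimate _) (by fun_prop), hols,
    ← Measure.map_map (by fun_prop) (by fun_prop), stdGaussian_map_euclMul, hAA]

end LeastSquares

namespace Views

variable {m d : ℕ} (V : Views m d) {S : Matrix (Fin d) (Fin d) ℝ} {σ : ℝ}

/-- The variance `ϑ_{i-}ᵀ Γ_{i-} ϑ_{i-} + σ²` of a label of agent `i` given its observed
features. -/
noncomputable def labelVar (S : Matrix (Fin d) (Fin d) ℝ) (σ : ℝ) (ϑ : EuclideanSpace ℝ (Fin d))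
    (i : Fin m) : ℝ :=
  (V.minus i ϑ).ofLp ⬝ᵥ V.schur S i *ᵥ (V.minus i ϑ).ofLp + σ ^ 2

lemma blockPP_posDef (hS : S.PosDef) (i : Fin m) : (V.blockPP i S).PosDef :=
  hS.submatrix fun a b hab => by simpa using (V.view i).injective hab

lemma blockMP_eq_transpose (hS : S.IsHermitian) (i : Fin m) :
    V.blockMP i S = (V.blockPM i S)ᵀ := by
  ext a b
  simpa [blockMP, blockPM] using (hS.apply (V.view i (Sum.inr a)) (V.view i (Sum.inl b))).symm

lemma submatrix_view (hS : S.IsHermitian) (i : Fin m) :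
    S.submatrix (V.view i) (V.view i) =
      fromBlocks (V.blockPP i S) (V.blockPM i S) (V.blockPM i S)ᴴ (V.blockMM i S) := by
  have hMP : V.blockMP i S = (V.blockPM i S)ᴴ := V.blockMP_eq_transpose hS i
  rw [← hMP]
  ext (a | a) (b | b) <;> rfl

lemma schur_posSemidef (hS : S.PosDef) (i : Fin m) : (V.schur S i).PosSemidef := by
  have hP := V.blockPP_posDef hS i
  have : Invertible (V.blockPP i S) := hP.isUnit.invertible
  have hschur := (PosDef.fromBlocks₁₁ (V.blockPM i S) (V.blockMM i S) hP).1
    (V.submatrix_view hS.isHermitian i ▸ hS.posSemidef.submatrix (V.view i))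
  rw [schur, V.blockMP_eq_transpose hS.isHermitian]
  simpa using hschur

lemma schur_quadratic_nonneg (hS : S.PosDef) (ϑ : EuclideanSpace ℝ (Fin d)) (i : Fin m) :
    0 ≤ (V.minus i ϑ).ofLp ⬝ᵥ V.schur S i *ᵥ (V.minus i ϑ).ofLp := by
  simpa using (V.schur_posSemidef hS i).dotProduct_mulVec_nonneg (V.minus i ϑ).ofLp

lemma labelVar_pos (hS : S.PosDef) (hσ : 0 < σ) (ϑ : EuclideanSpace ℝ (Fin d)) (i : Fin m) :
    0 < V.labelVar S σ ϑ i :=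
  add_pos_of_nonneg_of_pos (V.schur_quadratic_nonneg hS ϑ i) (pow_pos hσ 2)

lemma continuous_labelVar (i : Fin m) : Continuous fun ϑ => V.labelVar S σ ϑ i := by
  unfold labelVar minus
  fun_prop

lemma euclMul_transfer (i : Fin m) (ϑ : EuclideanSpace ℝ (Fin d)) :
    euclMul (V.transfer S i) ϑ =
      V.plus i ϑ + euclMul ((V.blockPP i S)⁻¹ * V.blockPM i S) (V.minus i ϑ) := by
  ext a
  simp only [euclMul, transfer, mulVec, dotProduct, plus, minus, PiLp.add_apply]
  rw [← (V.view i).sum_comp]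
  simp [Fintype.sum_sum_type, Matrix.one_apply]

lemma inner_plus_add_inner_conditionalMean (hS : S.IsHermitian) (i : Fin m)
    (x : EuclideanSpace ℝ (Fin (V.obs i))) (ϑ : EuclideanSpace ℝ (Fin d)) :
    inner ℝ x (V.plus i ϑ) +
        inner ℝ (euclMul (V.blockMP i S * (V.blockPP i S)⁻¹) x) (V.minus i ϑ) =
      inner ℝ x (euclMul (V.transfer S i) ϑ) := by
  have hsymm : (V.blockPP i S)ᵀ = V.blockPP i S := hS.submatrix _
  rw [inner_euclMul, V.euclMul_transfer, inner_add_right, transpose_mul, transpose_nonsing_inv,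
    hsymm, V.blockMP_eq_transpose hS, transpose_transpose]

instance (i : Fin m) (x : EuclideanSpace ℝ (Fin (V.obs i))) :
    IsProbabilityMeasure (V.hiddenRowLaw S σ i x) := by
  unfold hiddenRowLaw
  infer_instance

lemma map_label_hiddenRowLaw (hS : S.PosDef) (i : Fin m) (x : EuclideanSpace ℝ (Fin (V.obs i)))
    (ϑ : EuclideanSpace ℝ (Fin d)) :
    (V.hiddenRowLaw S σ i x).map
        (fun h => inner ℝ x (V.plus i ϑ) + inner ℝ h.1 (V.minus i ϑ) + h.2) =
      gaussianReal (inner ℝ x (euclMul (V.transfer S i) ϑ)) (V.labelVar S σ ϑ i).toNNReal := by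
  have hlabel : (fun h : EuclideanSpace ℝ (Fin (V.hid i)) × ℝ =>
      inner ℝ x (V.plus i ϑ) + inner ℝ h.1 (V.minus i ϑ) + h.2) =
      (inner ℝ x (V.plus i ϑ) + ·) ∘ (fun q : ℝ × ℝ => q.1 + q.2) ∘
        Prod.map (fun z => inner ℝ z (V.minus i ϑ)) id := by
    ext h
    simp [add_assoc]
  have hsum (μ : ℝ) (v w : NNReal) : ((gaussianReal μ v).prod (gaussianReal 0 w)).map
      (fun q : ℝ × ℝ => q.1 + q.2) = gaussianReal (μ + 0) (v + w) :=
    gaussianReal_conv_gaussianReal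
  rw [hlabel, ← Measure.map_map (by fun_prop) (by fun_prop),
    ← Measure.map_map (by fun_prop) (by fun_prop), hiddenRowLaw,
    ← Measure.map_prod_map _ _ (by fun_prop) measurable_id, Measure.map_id,
    multivariateGaussian_map_inner _ (V.schur_posSemidef hS i), hsum, gaussianReal_map_const_add,
    add_zero, add_comm, V.inner_plus_add_inner_conditionalMean hS.isHermitian, labelVar,
    Real.toNNReal_add (V.schur_quadratic_nonneg hS ϑ i) (sq_nonneg σ)]

variable {n : ℕ}

lemma measurable_fixedLabels (ϑ : EuclideanSpace ℝ (Fin d)) (i : Fin m)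
    (X : Fin n → EuclideanSpace ℝ (Fin (V.obs i))) : Measurable (V.fixedLabels ϑ i X) := by
  unfold fixedLabels
  fun_prop

lemma map_fixedLabels (hS : S.PosDef) (ϑ : EuclideanSpace ℝ (Fin d)) (i : Fin m)
    (X : Fin n → EuclideanSpace ℝ (Fin (V.obs i))) :
    (Measure.pi fun k => V.hiddenRowLaw S σ i (X k)).map (V.fixedLabels ϑ i X) =
      Measure.pi fun k => gaussianReal (inner ℝ (X k) (euclMul (V.transfer S i) ϑ))
        (V.labelVar S σ ϑ i).toNNReal := by
  simp_rw [← V.map_label_hiddenRowLaw hS i]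
  rw [← Measure.pi_map_pi fun k => by fun_prop]
  rfl

lemma olsLaw_eq_map_pi (hS : S.PosDef) (hσ : 0 < σ)
    {X : (i : Fin m) → Fin n → EuclideanSpace ℝ (Fin (V.obs i))}
    (hX : ∀ i, (designGram (X i)).PosDef) (ϑ : EuclideanSpace ℝ (Fin d)) :
    V.olsLaw S σ X ϑ =
      (Measure.pi fun i => multivariateGaussian 0
        (V.labelVar S σ ϑ i • (designGram (X i))⁻¹)).map
          (fun g i => euclMul (V.transfer S i) ϑ + g i) := by
  have hagent (i : Fin m) : (Measure.pi fun k => V.hiddenRowLaw S σ i (X i k)).map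
      (fun h => olsEstimate (designMatrix (X i)) (V.fixedLabels ϑ i (X i) h)) =
      (multivariateGaussian 0 (V.labelVar S σ ϑ i • (designGram (X i))⁻¹)).map
        (euclMul (V.transfer S i) ϑ + ·) := by
    rw [← map_olsEstimate_pi_gaussianReal (hX i) _ (V.labelVar_pos hS hσ ϑ i).le,
      ← V.map_fixedLabels hS ϑ i (X i),
      Measure.map_map (measurable_olsEstimate _) (V.measurable_fixedLabels ϑ i (X i))]
    rfl
  have hmeas (i : Fin m) : Measurable
      fun h => olsEstimate (designMatrix (X i)) (V.fixedLabels ϑ i (X i) h) :=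
    (measurable_olsEstimate _).comp (V.measurable_fixedLabels ϑ i (X i))
  rw [olsLaw, Measure.pi_map_pi (f := fun i h => olsEstimate (designMatrix (X i))
    (V.fixedLabels ϑ i (X i) h)) fun i => (hmeas i).aemeasurable]
  simp_rw [hagent]
  rw [Measure.pi_map_pi (f := fun i g => euclMul (V.transfer S i) ϑ + g) fun i => by fun_prop]

lemma le_olsLaw (hS : S.PosDef) (hσ : 0 < σ)
    {X : (i : Fin m) → Fin n → EuclideanSpace ℝ (Fin (V.obs i))}
    (hX : ∀ i, (designGram (X i)).PosDef) (ϑ : EuclideanSpace ℝ (Fin d))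
    {v : Fin m → ℝ} {r : ℝ} (hr : 0 < r) (hv : ∀ i, 0 < v i)
    (hle : ∀ i, v i ≤ V.labelVar S σ ϑ i) (hle' : ∀ i, V.labelVar S σ ϑ i ≤ r ^ 2 * v i) :
    (∏ i, ENNReal.ofReal r⁻¹ ^ V.obs i) •
      (Measure.pi fun i => multivariateGaussian 0 (v i • (designGram (X i))⁻¹)).map
        (fun g i => euclMul (V.transfer S i) ϑ + g i) ≤ V.olsLaw S σ X ϑ := by
  rw [V.olsLaw_eq_map_pi hS hσ hX, ← Measure.map_smul]
  exact Measure.map_mono (pi_smul_le_pi fun i => multivariateGaussian_smul_le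
    (designGram_posSemidef (X i)).inv (hv i) hr (hle i) (hle' i)) (by fun_prop)

/-- The Fisher information per sample in the direction `w` of the fixed design `X`, when the label
variance of agent `i` is the constant `v i`. -/
noncomputable def designInformation (S : Matrix (Fin d) (Fin d) ℝ) (v : Fin m → ℝ)
    (X : (i : Fin m) → Fin n → EuclideanSpace ℝ (Fin (V.obs i))) (w : EuclideanSpace ℝ (Fin d)) :
    ℝ :=
  ∑ i, (v i)⁻¹ * inner ℝ (euclMul (V.transfer S i) w)
    (euclMul ((n : ℝ)⁻¹ • designGram (X i)) (euclMul (V.transfer S i) w))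

lemma sum_inner_euclMul_inv_eq_designInformation {v : Fin m → ℝ} (hv : ∀ i, v i ≠ 0)
    {X : (i : Fin m) → Fin n → EuclideanSpace ℝ (Fin (V.obs i))}
    (hX : ∀ i, (designGram (X i)).PosDef) (w : EuclideanSpace ℝ (Fin d)) :
    ∑ i, inner ℝ ((√(n : ℝ))⁻¹ • euclMul (V.transfer S i) w)
      (euclMul (v i • (designGram (X i))⁻¹)⁻¹ ((√(n : ℝ))⁻¹ • euclMul (V.transfer S i) w)) =
        V.designInformation S v X w := by
  refine Finset.sum_congr rfl fun i _ => ?_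
  have hinv : (v i • (designGram (X i))⁻¹)⁻¹ = (v i)⁻¹ • designGram (X i) := by
    refine inv_eq_left_inv ?_
    rw [Matrix.smul_mul, Matrix.mul_smul, smul_smul, inv_mul_cancel₀ (hv i), one_smul,
      mul_nonsing_inv _ (hX i).det_pos.ne'.isUnit]
  have hsqrt : (√(n : ℝ))⁻¹ * (√(n : ℝ))⁻¹ = (n : ℝ)⁻¹ := by
    rw [← mul_inv, Real.mul_self_sqrt n.cast_nonneg]
  rw [hinv, smul_euclMul, smul_euclMul, euclMul_smul, real_inner_smul_left,
    real_inner_smul_right, real_inner_smul_right, real_inner_smul_right, ← hsqrt]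
  ring

variable {s : ℕ} {X : (i : Fin m) → Fin n → EuclideanSpace ℝ (Fin (V.obs i))} {v : Fin m → ℝ}
  {ψ : EuclideanSpace ℝ (Fin d) → EuclideanSpace ℝ (Fin s)} {u : EuclideanSpace ℝ (Fin s)}
  {u' : EuclideanSpace ℝ (Fin d)}

lemma mul_lintegral_shift_le_lintegral_olsLaw (hS : S.PosDef) (hσ : 0 < σ)
    (hX : ∀ i, (designGram (X i)).PosDef) (hn : 0 < n) {r : ℝ} (hr : 0 < r) (hv : ∀ i, 0 < v i)
    (hψ : ∀ ϑ, inner ℝ u (ψ ϑ) = inner ℝ u' ϑ)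
    {est : ((i : Fin m) → EuclideanSpace ℝ (Fin (V.obs i))) → EuclideanSpace ℝ (Fin s)}
    (hest : Measurable est) (θ w : EuclideanSpace ℝ (Fin d)) (t : ℝ)
    (hvar : ∀ i, v i ≤ V.labelVar S σ (θ + (t * (√(n : ℝ))⁻¹) • w) i ∧
      V.labelVar S σ (θ + (t * (√(n : ℝ))⁻¹) • w) i ≤ r ^ 2 * v i) :
    (∏ i, ENNReal.ofReal r⁻¹ ^ V.obs i) *
      ∫⁻ g, ENNReal.ofReal ((√(n : ℝ) * (inner ℝ u (est ((fun i => euclMul (V.transfer S i) θ) +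
        (t • (fun i => (√(n : ℝ))⁻¹ • euclMul (V.transfer S i) w) + g))) - inner ℝ u' θ) -
          inner ℝ u' w * t) ^ 2)
        ∂(Measure.pi fun i => multivariateGaussian 0 (v i • (designGram (X i))⁻¹)) ≤
      ∫⁻ z, ENNReal.ofReal (n * inner ℝ u (est z - ψ (θ + (t * (√(n : ℝ))⁻¹) • w)) ^ 2)
        ∂(V.olsLaw S σ X (θ + (t * (√(n : ℝ))⁻¹) • w)) := by
  have hnR : (0 : ℝ) < n := by exact_mod_cast hn
  have hsqrt : √(n : ℝ) ≠ 0 := (Real.sqrt_pos.2 hnR).ne'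
  refine le_trans (le_of_eq ?_) (lintegral_mono' (V.le_olsLaw hS hσ hX _ hr hv
    (fun i => (hvar i).1) fun i => (hvar i).2) le_rfl)
  rw [lintegral_smul_measure, lintegral_map (by fun_prop) (by fun_prop), smul_eq_mul]
  congr 1
  refine lintegral_congr fun g => congrArg ENNReal.ofReal ?_
  have hshift : (fun i => euclMul (V.transfer S i) (θ + (t * (√(n : ℝ))⁻¹) • w) + g i) =
      (fun i => euclMul (V.transfer S i) θ) +
        (t • (fun i => (√(n : ℝ))⁻¹ • euclMul (V.transfer S i) w) + g) := by
    ext1 i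
    simp only [euclMul_add, euclMul_smul, Pi.add_apply, Pi.smul_apply, smul_smul]
    abel
  have hscale (e : ℝ) : (n : ℝ) * e ^ 2 = (√(n : ℝ) * e) ^ 2 := by
    rw [mul_pow, Real.sq_sqrt hnR.le]
  rw [hshift, inner_sub_right, hψ, inner_add_right, real_inner_smul_right]
  rw [hscale]
  congr 1
  field_simp
  ring

lemma le_minimaxRisk (hS : S.PosDef) (hσ : 0 < σ) (θ : EuclideanSpace ℝ (Fin d)) (hn : 0 < n)
    (hX : ∀ i, (designGram (X i)).PosDef) {c r : ℝ} (hr : 0 < r) (hv : ∀ i, 0 < v i)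
    (hball : ∀ ϑ, ‖ϑ - θ‖ ≤ c / √(n : ℝ) → ∀ i,
      v i ≤ V.labelVar S σ ϑ i ∧ V.labelVar S σ ϑ i ≤ r ^ 2 * v i)
    (hψ : ∀ ϑ, inner ℝ u (ψ ϑ) = inner ℝ u' ϑ)
    {w : EuclideanSpace ℝ (Fin d)} {M : ℝ} (hM : 0 ≤ M) (hMc : M * ‖w‖ ≤ c)
    (hI : 0 < V.designInformation S v X w) (τ : NNReal) :
    (∏ i, ENNReal.ofReal r⁻¹ ^ V.obs i) *
      (ENNReal.ofReal (inner ℝ u' w ^ 2 * (τ * (V.designInformation S v X w)⁻¹ /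
          (τ + (V.designInformation S v X w)⁻¹))) -
        ∫⁻ t in {t | M < |t|}, ENNReal.ofReal (4 * inner ℝ u' w ^ 2 * t ^ 2) ∂(gaussianReal 0 τ))
      ≤ V.minimaxRisk S σ θ X ψ c u := by
  refine le_iInf₂ fun est hest => ?_
  set κ : ℝ≥0∞ := ∏ i, ENNReal.ofReal r⁻¹ ^ V.obs i
  set R := ⨆ (ϑ : EuclideanSpace ℝ (Fin d)) (_ : ‖ϑ - θ‖ ≤ c / √(n : ℝ)),
    ∫⁻ z, ENNReal.ofReal (n * inner ℝ u (est z - ψ ϑ) ^ 2) ∂(V.olsLaw S σ X ϑ)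
  have hκ0 : κ ≠ 0 := Finset.prod_ne_zero_iff.2 fun i _ =>
    pow_ne_zero _ (ENNReal.ofReal_pos.2 (inv_pos.2 hr)).ne'
  have hκt : κ ≠ ∞ := ENNReal.prod_ne_top fun i _ => ENNReal.pow_ne_top ENNReal.ofReal_ne_top
  have hinfo := V.sum_inner_euclMul_inv_eq_designInformation (S := S) (fun i => (hv i).ne') hX w
  obtain ⟨ℓ, hℓ, hcov⟩ := exists_efficient_functional (fun i => (hX i).inv.smul (hv i))
    (fun i => (√(n : ℝ))⁻¹ • euclMul (V.transfer S i) w) (hinfo.trans_ne hI.ne')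
  rw [hinfo] at hcov
  have hball_line {t : ℝ} (ht : |t| ≤ M) :
      ‖θ + (t * (√(n : ℝ))⁻¹) • w - θ‖ ≤ c / √(n : ℝ) := by
    rw [add_sub_cancel_left, norm_smul, Real.norm_eq_abs, abs_mul,
      abs_of_nonneg (inv_nonneg.2 (Real.sqrt_nonneg _)), div_eq_mul_inv, mul_right_comm]
    gcongr
    exact (mul_le_mul_of_nonneg_right ht (norm_nonneg w)).trans hMc
  have hrisk (t : ℝ) (ht : |t| ≤ M) := (ENNReal.mul_le_iff_le_inv hκ0 hκt).1
    ((V.mul_lintegral_shift_le_lintegral_olsLaw hS hσ hX hn hr hv hψ hest θ w t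
      (hball _ (hball_line ht))).trans (le_iSup₂ (f := fun ϑ (_ : ‖ϑ - θ‖ ≤ c / √(n : ℝ)) =>
        ∫⁻ z, ENNReal.ofReal (n * inner ℝ u (est z - ψ ϑ) ^ 2) ∂(V.olsLaw S σ X ϑ)) _
          (hball_line ht)))
  have hbayes := le_minimax_gaussianShift hℓ (inv_pos.2 hI) hcov τ
    (δ := fun z => √(n : ℝ) * (inner ℝ u
      (est ((fun i => euclMul (V.transfer S i) θ) + z)) - inner ℝ u' θ))
    (by fun_prop) (inner ℝ u' w) hM hrisk
  calc κ * _ ≤ κ * (κ⁻¹ * R) := by gcongr; exact tsub_le_iff_right.2 hbayes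
    _ = R := by rw [← mul_assoc, ENNReal.mul_inv_cancel hκ0 hκt, one_mul]

end Views

section GramLimits

variable {p : ℕ}

lemma eventually_posDef_designGram {A : Matrix (Fin p) (Fin p) ℝ} (hA : A.PosDef)
    {X : (n : ℕ) → Fin n → EuclideanSpace ℝ (Fin p)}
    (hX : Tendsto (fun n : ℕ => (n : ℝ)⁻¹ • designGram (X n)) atTop (nhds A)) :
    ∀ᶠ n in atTop, (designGram (X n)).PosDef := by
  have hdet : Tendsto (fun n : ℕ => ((n : ℝ)⁻¹ • designGram (X n)).det) atTop (nhds A.det) :=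
    (continuous_id.matrix_det.tendsto A).comp hX
  filter_upwards [hdet.eventually_ne hA.det_pos.ne'] with n hn
  rw [(designGram_posSemidef (X n)).posDef_iff_isUnit, Matrix.isUnit_iff_isUnit_det,
    isUnit_iff_ne_zero]
  rw [det_smul] at hn
  exact right_ne_zero_of_mul hn

lemma holderTriple_eight_eight_four : ENNReal.HolderTriple 8 8 4 :=
  .of_toReal (by constructor <;> norm_num)

lemma ae_tendsto_designGram {Ω : Type*} [MeasurableSpace Ω] {P : Measure Ω}
    [IsProbabilityMeasure P] {K : Matrix (Fin p) (Fin p) ℝ} (hK : K.PosSemidef)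
    {Z : (n : ℕ) → Fin n → Ω → EuclideanSpace ℝ (Fin p)}
    (hlaw : ∀ n k, HasLaw (Z n k) (multivariateGaussian 0 K) P) (hind : ∀ n, iIndepFun (Z n) P) :
    ∀ᵐ ω ∂P, Tendsto (fun n : ℕ => (n : ℝ)⁻¹ • designGram (fun k => Z n k ω)) atTop
      (nhds K) := by
  have hmem (a : Fin p) : MemLp (fun x : EuclideanSpace ℝ (Fin p) => x a) 8
      (multivariateGaussian 0 K) :=
    IsGaussian.memLp_dual _ (EuclideanSpace.proj a) 8 (by simp)
  have hmean (a : Fin p) : ∫ x : EuclideanSpace ℝ (Fin p), x a ∂(multivariateGaussian 0 K) = 0 := by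
    simpa using (EuclideanSpace.proj (𝕜 := ℝ) a).integral_comp_id_comm
      (IsGaussian.integrable_id (μ := multivariateGaussian 0 K))
  have hprod (a b : Fin p) : MemLp (fun x : EuclideanSpace ℝ (Fin p) => x a * x b) 4
      (multivariateGaussian 0 K) := by
    have := holderTriple_eight_eight_four
    exact (hmem b).mul' (hmem a)
  have hmoment (a b : Fin p) :
      ∫ x : EuclideanSpace ℝ (Fin p), x a * x b ∂(multivariateGaussian 0 K) = K a b := by
    have hcov := covariance_eval_multivariateGaussian (μ := 0) hK a b
    rwa [covariance_eq_sub ((hmem a).mono_exponent (by norm_num))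
      ((hmem b).mono_exponent (by norm_num)), hmean, zero_mul, sub_zero] at hcov
  have hentry (a b : Fin p) := ae_tendsto_rowMean hlaw hind (by fun_prop) (hprod a b)
  filter_upwards [ae_all_iff.2 fun a => ae_all_iff.2 fun b => hentry a b] with ω hω
  refine tendsto_pi_nhds.2 fun a => tendsto_pi_nhds.2 fun b => ?_
  simpa [Matrix.mul_apply, hmoment] using hω a b

end GramLimits

namespace Views

variable {m d : ℕ} (V : Views m d) {S : Matrix (Fin d) (Fin d) ℝ} {σ : ℝ}

lemma inner_euclMul_precision (θ w : EuclideanSpace ℝ (Fin d)) :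
    inner ℝ w (euclMul (V.precision S σ θ) w) = ∑ i, (V.labelVar S σ θ i)⁻¹ *
      inner ℝ (euclMul (V.transfer S i) w)
        (euclMul (V.blockPP i S) (euclMul (V.transfer S i) w)) := by
  have hweight (i : Fin m) :
      V.gaussWeight S σ θ i = (V.labelVar S σ θ i)⁻¹ • V.blockPP i S := rfl
  rw [real_inner_eq_dotProduct, euclMul_apply, precision, sum_mulVec, dotProduct_sum]
  refine Finset.sum_congr rfl fun i _ => ?_
  rw [← euclMul_apply, ← real_inner_eq_dotProduct, Matrix.mul_assoc, ← euclMul_euclMul,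
    real_inner_comm, inner_euclMul, transpose_transpose, real_inner_comm, hweight,
    ← euclMul_euclMul, smul_euclMul, real_inner_smul_right]

lemma precision_posSemidef (hS : S.PosDef) (hσ : 0 < σ) (θ : EuclideanSpace ℝ (Fin d)) :
    (V.precision S σ θ).PosSemidef := by
  refine posSemidef_sum _ fun i _ => ?_
  have hweight : (V.gaussWeight S σ θ i).PosSemidef :=
    (V.blockPP_posDef hS i).posSemidef.smul (inv_pos.2 (V.labelVar_pos hS hσ θ i)).le
  simpa using hweight.conjTranspose_mul_mul_same (V.transfer S i)

lemma covG_posSemidef (hS : S.PosDef) (hσ : 0 < σ) (θ : EuclideanSpace ℝ (Fin d)) :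
    (V.covG S σ θ).PosSemidef :=
  (V.precision_posSemidef hS hσ θ).inv

lemma precision_mul_covG {θ : EuclideanSpace ℝ (Fin d)} (hC : IsUnit (V.precision S σ θ)) :
    V.precision S σ θ * V.covG S σ θ = 1 :=
  mul_nonsing_inv _ ((Matrix.isUnit_iff_isUnit_det _).1 hC)

section LowerBound

variable {X : (n : ℕ) → (i : Fin m) → Fin n → EuclideanSpace ℝ (Fin (V.obs i))}
  {s : ℕ} {ψ : EuclideanSpace ℝ (Fin d) → EuclideanSpace ℝ (Fin s)} {u : EuclideanSpace ℝ (Fin s)}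
  {u' θ : EuclideanSpace ℝ (Fin d)}

lemma tendsto_designInformation
    (hX : ∀ i, Tendsto (fun n : ℕ => (n : ℝ)⁻¹ • designGram (X n i)) atTop
      (nhds (V.blockPP i S))) (θ w : EuclideanSpace ℝ (Fin d)) (r : ℝ) :
    Tendsto (fun n => V.designInformation S (fun i => V.labelVar S σ θ i / r) (X n) w) atTop
      (nhds (r * inner ℝ w (euclMul (V.precision S σ θ) w))) := by
  rw [inner_euclMul_precision, Finset.mul_sum]
  refine tendsto_finsetSum _ fun i _ => ?_
  rw [← mul_assoc, ← div_eq_mul_inv, ← inv_div]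
  have hcont : Continuous fun A : Matrix (Fin (V.obs i)) (Fin (V.obs i)) ℝ =>
      inner ℝ (euclMul (V.transfer S i) w) (euclMul A (euclMul (V.transfer S i) w)) := by
    unfold euclMul
    fun_prop
  exact ((hcont.tendsto _).comp (hX i)).const_mul _

lemma eventually_labelVar_mem_Icc (hS : S.PosDef) (hσ : 0 < σ) (θ : EuclideanSpace ℝ (Fin d))
    {r : ℝ} (hr : 1 < r) (c : ℝ) :
    ∀ᶠ n : ℕ in atTop, ∀ ϑ, ‖ϑ - θ‖ ≤ c / √(n : ℝ) → ∀ i,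
      V.labelVar S σ θ i / r ≤ V.labelVar S σ ϑ i ∧
        V.labelVar S σ ϑ i ≤ r ^ 2 * (V.labelVar S σ θ i / r) := by
  have hnear : ∀ᶠ ϑ in nhds θ, ∀ i, V.labelVar S σ θ i / r ≤ V.labelVar S σ ϑ i ∧
      V.labelVar S σ ϑ i ≤ r ^ 2 * (V.labelVar S σ θ i / r) := by
    refine eventually_all.2 fun i => ?_
    have hpos := V.labelVar_pos hS hσ θ i
    have hlt : V.labelVar S σ θ i / r < V.labelVar S σ θ i := div_lt_self hpos hr
    have hgt : V.labelVar S σ θ i < r ^ 2 * (V.labelVar S σ θ i / r) := by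
      have hcancel : r ^ 2 * (V.labelVar S σ θ i / r) = r * V.labelVar S σ θ i := by
        field_simp
      rw [hcancel]
      exact lt_mul_of_one_lt_left hpos hr
    have hcont := (V.continuous_labelVar (S := S) (σ := σ) i).tendsto θ
    filter_upwards [hcont.eventually_const_lt hlt, hcont.eventually_lt_const hgt] with ϑ h h'
      using ⟨h.le, h'.le⟩
  obtain ⟨ρ, hρ, hball⟩ := Metric.eventually_nhds_iff.1 hnear
  have hradius : Tendsto (fun n : ℕ => c / √(n : ℝ)) atTop (nhds 0) :=
    tendsto_const_nhds.div_atTop (Real.tendsto_sqrt_atTop.comp tendsto_natCast_atTop_atTop)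
  filter_upwards [hradius.eventually_lt_const hρ] with n hn ϑ hϑ
  exact hball (by rw [dist_eq_norm]; exact hϑ.trans_lt hn)

lemma le_liminf_minimaxRisk_of_radius (hS : S.PosDef) (hσ : 0 < σ)
    (hX : ∀ i, Tendsto (fun n : ℕ => (n : ℝ)⁻¹ • designGram (X n i)) atTop
      (nhds (V.blockPP i S)))
    (hψ : ∀ ϑ, inner ℝ u (ψ ϑ) = inner ℝ u' ϑ) {w : EuclideanSpace ℝ (Fin d)} {J : ℝ}
    (hJ : inner ℝ w (euclMul (V.precision S σ θ) w) = J) (hJ0 : 0 < J) {r c M : ℝ} (hr : 1 < r)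
    (hM : 0 ≤ M) (hMc : M * ‖w‖ ≤ c) (τ : NNReal) :
    (∏ i, ENNReal.ofReal r⁻¹ ^ V.obs i) *
      (ENNReal.ofReal (inner ℝ u' w ^ 2 * (τ * (r * J)⁻¹ / (τ + (r * J)⁻¹))) -
        ∫⁻ t in {t | M < |t|}, ENNReal.ofReal (4 * inner ℝ u' w ^ 2 * t ^ 2) ∂(gaussianReal 0 τ))
      ≤ liminf (fun n : ℕ => V.minimaxRisk S σ θ (X n) ψ c u) atTop := by
  have hr0 : 0 < r := one_pos.trans hr
  have hrJ : 0 < r * J := mul_pos hr0 hJ0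
  have hinfo := V.tendsto_designInformation (σ := σ) hX θ w r
  rw [hJ] at hinfo
  have hbayes : Tendsto (fun n => (τ : ℝ) *
      (V.designInformation S (fun i => V.labelVar S σ θ i / r) (X n) w)⁻¹ /
        (τ + (V.designInformation S (fun i => V.labelVar S σ θ i / r) (X n) w)⁻¹)) atTop
      (nhds (τ * (r * J)⁻¹ / (τ + (r * J)⁻¹))) :=
    ((hinfo.inv₀ hrJ.ne').const_mul _).div ((hinfo.inv₀ hrJ.ne').const_add _) (by positivity)
  have hlim := ENNReal.Tendsto.const_mul (a := ∏ i, ENNReal.ofReal r⁻¹ ^ V.obs i)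
    (ENNReal.Tendsto.sub (ENNReal.tendsto_ofReal (hbayes.const_mul (inner ℝ u' w ^ 2)))
      (tendsto_const_nhds (x := ∫⁻ t in {t | M < |t|},
        ENNReal.ofReal (4 * inner ℝ u' w ^ 2 * t ^ 2) ∂(gaussianReal 0 τ)))
      (Or.inl ENNReal.ofReal_ne_top))
    (Or.inr (ENNReal.prod_ne_top fun i _ => ENNReal.pow_ne_top ENNReal.ofReal_ne_top))
  rw [← hlim.liminf_eq]
  refine liminf_le_liminf ?_
  filter_upwards [eventually_all.2 fun i => eventually_posDef_designGram
      (V.blockPP_posDef hS i) (hX i), V.eventually_labelVar_mem_Icc hS hσ θ hr c,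
    hinfo.eventually_const_lt hrJ, eventually_gt_atTop 0] with n hgram hball hpos hn
  exact V.le_minimaxRisk hS hσ θ hn hgram hr0
    (fun i => div_pos (V.labelVar_pos hS hσ θ i) hr0) hball hψ hM hMc hpos τ

lemma le_liminf_liminf_minimaxRisk (hS : S.PosDef) (hσ : 0 < σ)
    (hX : ∀ i, Tendsto (fun n : ℕ => (n : ℝ)⁻¹ • designGram (X n i)) atTop
      (nhds (V.blockPP i S)))
    (hψ : ∀ ϑ, inner ℝ u (ψ ϑ) = inner ℝ u' ϑ) {w : EuclideanSpace ℝ (Fin d)} {J : ℝ}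
    (hJ : inner ℝ w (euclMul (V.precision S σ θ) w) = J) (hJ0 : 0 < J) {r : ℝ} (hr : 1 < r)
    (τ : NNReal) :
    (∏ i, ENNReal.ofReal r⁻¹ ^ V.obs i) *
      ENNReal.ofReal (inner ℝ u' w ^ 2 * (τ * (r * J)⁻¹ / (τ + (r * J)⁻¹))) ≤
      liminf (fun c : ℝ => liminf (fun n : ℕ =>
        V.minimaxRisk S σ θ (X n) ψ c u) atTop) atTop := by
  have hsq : ∫⁻ t, ENNReal.ofReal (4 * inner ℝ u' w ^ 2 * t ^ 2) ∂(gaussianReal 0 τ) ≠ ∞ := by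
    have hint : Integrable (fun t : ℝ => t ^ 2) (gaussianReal 0 τ) :=
      (memLp_id_gaussianReal 2).integrable_sq
    exact (hint.const_mul _).lintegral_lt_top.ne
  have htail := (tendsto_setLIntegral_tail_zero hsq).comp
    (tendsto_id.atTop_div_const (by positivity : 0 < ‖w‖ + 1))
  have hlim := ENNReal.Tendsto.const_mul (a := ∏ i, ENNReal.ofReal r⁻¹ ^ V.obs i)
    (ENNReal.Tendsto.sub (tendsto_const_nhds
      (x := ENNReal.ofReal (inner ℝ u' w ^ 2 * (τ * (r * J)⁻¹ / (τ + (r * J)⁻¹))))) htail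
      (Or.inl ENNReal.ofReal_ne_top))
    (Or.inr (ENNReal.prod_ne_top fun i _ => ENNReal.pow_ne_top ENNReal.ofReal_ne_top))
  rw [tsub_zero] at hlim
  rw [← hlim.liminf_eq]
  refine liminf_le_liminf ?_
  filter_upwards [eventually_ge_atTop 0] with c hc
  refine V.le_liminf_minimaxRisk_of_radius hS hσ hX hψ hJ hJ0 hr
    (div_nonneg hc (by positivity)) ?_ τ
  change c / (‖w‖ + 1) * ‖w‖ ≤ c
  rw [div_mul_eq_mul_div, div_le_iff₀ (by positivity)]
  gcongr
  exact (lt_add_one _).le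

lemma ofReal_sq_div_le_liminf_minimaxRisk (hS : S.PosDef) (hσ : 0 < σ)
    (hX : ∀ i, Tendsto (fun n : ℕ => (n : ℝ)⁻¹ • designGram (X n i)) atTop
      (nhds (V.blockPP i S)))
    (hψ : ∀ ϑ, inner ℝ u (ψ ϑ) = inner ℝ u' ϑ) {w : EuclideanSpace ℝ (Fin d)} {J : ℝ}
    (hJ : inner ℝ w (euclMul (V.precision S σ θ) w) = J) (hJ0 : 0 < J) :
    ENNReal.ofReal (inner ℝ u' w ^ 2 / J) ≤
      liminf (fun c : ℝ => liminf (fun n : ℕ =>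
        V.minimaxRisk S σ θ (X n) ψ c u) atTop) atTop := by
  have hε : Tendsto (fun ε : ℝ => ε) (nhdsWithin 0 (Set.Ioi 0)) (nhds 0) :=
    tendsto_nhdsWithin_of_tendsto_nhds tendsto_id
  have hprod : Tendsto (fun ε : ℝ => ∏ i, ENNReal.ofReal (1 + ε)⁻¹ ^ V.obs i)
      (nhdsWithin 0 (Set.Ioi 0)) (nhds 1) := by
    have hone : Tendsto (fun ε : ℝ => ENNReal.ofReal (1 + ε)⁻¹) (nhdsWithin 0 (Set.Ioi 0))
        (nhds 1) := by
      simpa using ENNReal.tendsto_ofReal ((hε.const_add 1).inv₀ (by norm_num))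
    simpa using ENNReal.tendsto_finsetProd_of_ne_top (f := fun i (ε : ℝ) =>
      ENNReal.ofReal (1 + ε)⁻¹ ^ V.obs i) (a := fun _ => 1) Finset.univ
      (fun i _ => by simpa using ENNReal.Tendsto.pow hone) fun i _ => ENNReal.one_ne_top
  have hbayes : Tendsto (fun ε : ℝ => inner ℝ u' w ^ 2 * ((1 + ε) * J + ε)⁻¹)
      (nhdsWithin 0 (Set.Ioi 0)) (nhds (inner ℝ u' w ^ 2 / J)) := by
    simpa [div_eq_mul_inv] using ((((hε.const_add 1).mul_const J).add hε).inv₀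
      (by simpa using hJ0.ne')).const_mul (inner ℝ u' w ^ 2)
  have hlim := ENNReal.Tendsto.mul hprod (Or.inl one_ne_zero) (ENNReal.tendsto_ofReal hbayes)
    (Or.inr ENNReal.one_ne_top)
  rw [one_mul] at hlim
  refine le_of_tendsto hlim ?_
  filter_upwards [self_mem_nhdsWithin] with ε (hε0 : 0 < ε)
  have hvar : ((1 + ε) * J + ε)⁻¹ = ε⁻¹ * ((1 + ε) * J)⁻¹ / (ε⁻¹ + ((1 + ε) * J)⁻¹) := by
    field_simp
  rw [hvar]
  exact V.le_liminf_liminf_minimaxRisk hS hσ hX hψ hJ hJ0 (lt_add_of_pos_right 1 hε0)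
    ⟨ε⁻¹, (inv_pos.2 hε0).le⟩

lemma ofReal_covG_le_liminf_minimaxRisk (hS : S.PosDef) (hσ : 0 < σ)
    (hC : IsUnit (V.precision S σ θ))
    (hX : ∀ i, Tendsto (fun n : ℕ => (n : ℝ)⁻¹ • designGram (X n i)) atTop
      (nhds (V.blockPP i S)))
    (hψ : ∀ ϑ, inner ℝ u (ψ ϑ) = inner ℝ u' ϑ) :
    ENNReal.ofReal (u'.ofLp ⬝ᵥ V.covG S σ θ *ᵥ u'.ofLp) ≤
      liminf (fun c : ℝ => liminf (fun n : ℕ =>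
        V.minimaxRisk S σ θ (X n) ψ c u) atTop) atTop := by
  set q := u'.ofLp ⬝ᵥ V.covG S σ θ *ᵥ u'.ofLp
  rcases le_or_gt q 0 with hq | hq
  · rw [ENNReal.ofReal_of_nonpos hq]
    exact zero_le
  -- `C u'` is the least favourable direction: it maximizes `⟨u', w⟩² / ⟨w, C⁻¹ w⟩`.
  have hu' : inner ℝ u' (euclMul (V.covG S σ θ) u') = q := real_inner_eq_dotProduct _ _
  have hinfo : inner ℝ (euclMul (V.covG S σ θ) u')
      (euclMul (V.precision S σ θ) (euclMul (V.covG S σ θ) u')) = q := by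
    rw [euclMul_euclMul, V.precision_mul_covG hC, euclMul_one, real_inner_comm, hu']
  have hbound := V.ofReal_sq_div_le_liminf_minimaxRisk hS hσ hX hψ hinfo hq
  rwa [hu', sq, mul_div_assoc, div_self hq.ne', mul_one] at hbound

end LowerBound

lemma IsGaussianDesign.ae_tendsto_designGram (hS : S.PosDef) {Ω : Type*} [MeasurableSpace Ω]
    {P : Measure Ω} [IsProbabilityMeasure P]
    {X : (n : ℕ) → (i : Fin m) → Fin n → Ω → EuclideanSpace ℝ (Fin (V.obs i))}
    (hX : V.IsGaussianDesign S X P) :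
    ∀ᵐ ω ∂P, ∀ i, Tendsto (fun n : ℕ => (n : ℝ)⁻¹ • designGram (fun k => X n i k ω)) atTop
      (nhds (V.blockPP i S)) :=
  ae_all_iff.2 fun i => _root_.ae_tendsto_designGram (V.blockPP_posDef hS i).posSemidef
    (fun n k => hX.law n i k) fun n => hX.indep n i

end Views

section RowSumLimits

variable {Ω : Type*} [MeasurableSpace Ω] {P : Measure Ω}

lemma tendsto_charFun_pow_of_variance [IsProbabilityMeasure P] {Y : Ω → ℝ} (hY : MemLp Y 2 P)
    (hmean : ∫ ω, Y ω ∂P = 0) {q : ℝ} (hq : ∫ ω, Y ω ^ 2 ∂P = q) :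
    Tendsto (fun n : ℕ => (charFun (P.map Y) ((√(n : ℝ))⁻¹)) ^ n) atTop
      (nhds (Complex.exp (-q / 2))) := by
  have hYm : AEMeasurable Y P := hY.aestronglyMeasurable.aemeasurable
  have hq0 : 0 ≤ q := hq ▸ integral_nonneg fun ω => sq_nonneg _
  rcases hq0.eq_or_lt with rfl | hpos
  · have hzero : Y =ᵐ[P] fun _ => 0 := by
      filter_upwards [(integral_eq_zero_iff_of_nonneg (fun ω => sq_nonneg (Y ω))
        hY.integrable_sq).1 hq] with ω hω
      simpa using hω
    rw [Measure.map_congr hzero]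
    simp
  · have hnormalized : ∫ ω, ((fun ω => (√q)⁻¹ * Y ω) ^ 2) ω ∂P = 1 := by
      simp only [Pi.pow_apply, mul_pow]
      rw [integral_const_mul, hq, inv_pow, Real.sq_sqrt hq0, inv_mul_cancel₀ hpos.ne']
    have hclt := tendsto_charFun_inv_sqrt_mul_pow (hYm.const_mul (√q)⁻¹)
      (by rw [integral_const_mul, hmean, mul_zero]) hnormalized √q
    have hscale (n : ℕ) : charFun (P.map fun ω => (√q)⁻¹ * Y ω) ((√(n : ℝ))⁻¹ * √q) =
        charFun (P.map Y) ((√(n : ℝ))⁻¹) := by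
      have hsqrt : √q ≠ 0 := (Real.sqrt_pos.2 hpos).ne'
      rw [charFun_map_mul_comp hYm]
      congr 1
      field_simp
    simp_rw [hscale] at hclt
    convert hclt using 4
    rw [← Complex.ofReal_pow, Real.sq_sqrt hq0]

section CentralLimit

variable {ι : Type*} [Fintype ι] {𝓧 : ι → Type*} [∀ i, MeasurableSpace (𝓧 i)]
  {ν : (i : ι) → Measure (𝓧 i)} {p : ℕ} {F : (i : ι) → 𝓧 i → EuclideanSpace ℝ (Fin p)}

lemma charFun_map_smul_sum {n : ℕ} {Z : (q : ι × Fin n) → Ω → 𝓧 q.1}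
    (hlaw : ∀ q, HasLaw (Z q) (ν q.1) P) (hind : iIndepFun Z P) (hF : ∀ i, Measurable (F i))
    (c : ℝ) (t : EuclideanSpace ℝ (Fin p)) :
    charFun (P.map fun ω => c • ∑ q, F q.1 (Z q ω)) t =
      ∏ i, charFun ((ν i).map fun z => inner ℝ (F i z) t) c ^ n := by
  have hterm (q : ι × Fin n) : charFun (P.map fun ω => c • F q.1 (Z q ω)) t =
      charFun ((ν q.1).map fun z => inner ℝ (F q.1 z) t) c := by
    have hmap : P.map (fun ω => c • F q.1 (Z q ω)) = (ν q.1).map fun z => c • F q.1 z := by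
      rw [← (hlaw q).map_eq]
      exact (AEMeasurable.map_map_of_aemeasurable ((hF q.1).const_smul c).aemeasurable
        (hlaw q).aemeasurable).symm
    have hFq := hF q.1
    rw [hmap, charFun_apply, charFun_apply, integral_map (by fun_prop) (by fun_prop),
      integral_map (by fun_prop) (by fun_prop)]
    simp [real_inner_smul_left, mul_comm]
  simp_rw [Finset.smul_sum]
  rw [iIndepFun.charFun_map_fun_sum_eq_prod (X := fun q ω => c • F q.1 (Z q ω))
      (fun q => ((hF q.1).const_smul c).comp_aemeasurable (hlaw q).aemeasurable)
      (hind.comp (fun q z => c • F q.1 z) fun q => (hF q.1).const_smul c),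
    Finset.prod_apply, Finset.prod_congr rfl fun q _ => hterm q, Fintype.prod_prod_type]
  exact Finset.prod_congr rfl fun i _ =>
    Fin.prod_const n (charFun ((ν i).map fun z => inner ℝ (F i z) t) c)

lemma tendstoInDistribution_rowSum [IsProbabilityMeasure P] [∀ i, IsProbabilityMeasure (ν i)]
    {Z : (n : ℕ) → (q : ι × Fin n) → Ω → 𝓧 q.1}
    (hlaw : ∀ n q, HasLaw (Z n q) (ν q.1) P) (hind : ∀ n, iIndepFun (Z n) P)
    (hF : ∀ i, Measurable (F i)) (hmem : ∀ i t, MemLp (fun z => inner ℝ (F i z) t) 2 (ν i))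
    (hmean : ∀ i t, ∫ z, inner ℝ (F i z) t ∂(ν i) = 0) {K : Matrix (Fin p) (Fin p) ℝ}
    (hK : K.PosSemidef)
    (hcov : ∀ t, ∑ i, ∫ z, inner ℝ (F i z) t ^ 2 ∂(ν i) = inner ℝ t (euclMul K t)) :
    TendstoInDistribution (fun (n : ℕ) ω => (√(n : ℝ))⁻¹ • ∑ q, F q.1 (Z n q ω)) atTop id
      (fun _ => P) (multivariateGaussian 0 K) := by
  have hmeas (n : ℕ) : AEMeasurable (fun ω => ∑ q, F q.1 (Z n q ω)) P :=
    Finset.aemeasurable_fun_sum _ fun q _ => (hF q.1).comp_aemeasurable (hlaw n q).aemeasurable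
  refine ⟨fun n => (hmeas n).fun_const_smul _, aemeasurable_id, ?_⟩
  refine ProbabilityMeasure.tendsto_iff_tendsto_charFun.2 fun t => ?_
  have hfactors : Tendsto (fun n : ℕ => ∏ i,
      charFun ((ν i).map fun z => inner ℝ (F i z) t) (√(n : ℝ))⁻¹ ^ n) atTop
      (nhds (∏ i, Complex.exp (-(∫ z, inner ℝ (F i z) t ^ 2 ∂(ν i) : ℝ) / 2))) :=
    tendsto_finsetProd _ fun i _ => tendsto_charFun_pow_of_variance (hmem i t) (hmean i t) rfl
  have hlimit : charFun ((multivariateGaussian 0 K).map id) t =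
      ∏ i, Complex.exp (-(∫ z, inner ℝ (F i z) t ^ 2 ∂(ν i) : ℝ) / 2) := by
    rw [Measure.map_id, charFun_multivariateGaussian hK, ← Complex.exp_sum, ← euclMul_apply,
      ← real_inner_eq_dotProduct, ← hcov]
    congr 1
    simp only [inner_zero_right, Complex.ofReal_zero, zero_mul, zero_sub, Complex.ofReal_sum,
      neg_div, Finset.sum_neg_distrib, Finset.sum_div]
  simp only [ProbabilityMeasure.coe_mk, hlimit, charFun_map_smul_sum (hlaw _) (hind _) hF]
  exact hfactors

end CentralLimit

section Slutsky

lemma exists_forall_measure_ge_le [IsProbabilityMeasure P] {Q : ℕ → Ω → ℝ} (hQ0 : ∀ n ω, 0 ≤ Q n ω)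
    (hQ : ∀ n, Integrable (Q n) P) {K : ℝ} (hK : ∀ n, ∫ ω, Q n ω ∂P ≤ K) {δ : ℝ≥0∞} (hδ : 0 < δ) :
    ∃ L > 0, ∀ n, P {ω | L ≤ Q n ω} ≤ δ := by
  rcases eq_or_ne δ ∞ with rfl | hδt
  · exact ⟨1, one_pos, fun _ => le_top⟩
  have hK0 : 0 ≤ K := (integral_nonneg (hQ0 0)).trans (hK 0)
  have hδR : 0 < δ.toReal := ENNReal.toReal_pos hδ.ne' hδt
  refine ⟨(K + 1) / δ.toReal, by positivity, fun n => ?_⟩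
  have hmarkov := (mul_meas_ge_le_integral_of_nonneg (Eventually.of_forall (hQ0 n)) (hQ n)
    ((K + 1) / δ.toReal)).trans (hK n)
  rw [← ofReal_measureReal]
  refine ENNReal.ofReal_le_of_le_toReal ?_
  rw [mul_comm, ← le_div_iff₀ (by positivity)] at hmarkov
  refine hmarkov.trans ?_
  rw [div_div_eq_mul_div, div_le_iff₀ (by positivity)]
  nlinarith

lemma tendstoInMeasure_zero_of_ae_tendsto_div [IsProbabilityMeasure P] {E : Type*}
    [NormedAddCommGroup E] [MeasurableSpace E] [BorelSpace E] {D : ℕ → Ω → E}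
    (hD : ∀ n, AEMeasurable (D n) P) {Q : ℕ → Ω → ℝ} (hQ0 : ∀ n ω, 0 ≤ Q n ω)
    (hQ : ∀ n, Integrable (Q n) P) {K : ℝ} (hK : ∀ n, ∫ ω, Q n ω ∂P ≤ K)
    (hlim : ∀ᵐ ω ∂P, Tendsto (fun n => ‖D n ω‖ / (1 + Q n ω)) atTop (nhds 0)) :
    TendstoInMeasure P D atTop 0 := by
  have hratio : TendstoInMeasure P (fun n ω => ‖D n ω‖ / (1 + Q n ω)) atTop fun _ => (0 : ℝ) :=
    tendstoInMeasure_of_tendsto_ae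
      (fun n => ((hD n).norm.div ((hQ n).aemeasurable.const_add 1)).aestronglyMeasurable) hlim
  rw [tendstoInMeasure_iff_norm] at hratio ⊢
  refine fun ε hε => ENNReal.tendsto_nhds_zero.2 fun η hη => ?_
  obtain ⟨L, hL, hQL⟩ := exists_forall_measure_ge_le hQ0 hQ hK (ENNReal.half_pos hη.ne')
  filter_upwards [ENNReal.tendsto_nhds_zero.1 (hratio (ε / (1 + L)) (by positivity)) (η / 2)
    (ENNReal.half_pos hη.ne')] with n hn
  have hcover : {ω | ε ≤ ‖D n ω - (0 : Ω → E) ω‖} ⊆ {ω | L ≤ Q n ω} ∪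
      {ω | ε / (1 + L) ≤ ‖‖D n ω‖ / (1 + Q n ω) - 0‖} := by
    intro ω hω
    have hDω : ε ≤ ‖D n ω‖ := by simpa using hω
    refine (le_or_gt L (Q n ω)).imp id fun hlt => ?_
    have hQω := hQ0 n ω
    rw [Set.mem_ofPred_eq, sub_zero, Real.norm_eq_abs, abs_of_nonneg (by positivity)]
    exact div_le_div₀ (norm_nonneg _) hDω (by positivity) (by linarith)
  calc P {ω | ε ≤ ‖D n ω - (0 : Ω → E) ω‖}
      ≤ η / 2 + η / 2 := (measure_mono hcover).trans
        ((measure_union_le _ _).trans (add_le_add (hQL n) hn))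
    _ = η := ENNReal.add_halves η

lemma tendstoInDistribution_euclMul [IsProbabilityMeasure P] {p q : ℕ}
    {Y : ℕ → Ω → EuclideanSpace ℝ (Fin q)}
    {K : Matrix (Fin q) (Fin q) ℝ} (hK : K.PosSemidef) (A : Matrix (Fin p) (Fin q) ℝ)
    (h : TendstoInDistribution Y atTop id (fun _ => P) (multivariateGaussian 0 K)) :
    TendstoInDistribution (fun n ω => euclMul A (Y n ω)) atTop id (fun _ => P)
      (multivariateGaussian 0 (A * K * Aᵀ)) := by
  have hA := h.continuous_comp (continuous_euclMul A)
  have hlaw : (multivariateGaussian 0 K).map (euclMul A ∘ id) =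
      (multivariateGaussian 0 (A * K * Aᵀ)).map id := by
    have hzero : euclMul A 0 = 0 := by simp [euclMul]
    rw [Function.comp_id, multivariateGaussian_map_euclMul A 0 hK, hzero, Measure.map_id]
  refine ⟨hA.forall_aemeasurable, aemeasurable_id, ?_⟩
  have hlim := hA.tendsto
  simp_rw [hlaw] at hlim
  exact hlim

end Slutsky

end RowSumLimits

section GaussianRegression

variable {p q : ℕ} {K : Matrix (Fin p) (Fin p) ℝ}

/-- The law of a sample `(x, e)` of a Gaussian linear regression: features `x` with law `N(0, K)`
and independent noise `e` with law `N(0, v)`. -/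
noncomputable abbrev regressionLaw (K : Matrix (Fin p) (Fin p) ℝ) (v : NNReal) :
    Measure (EuclideanSpace ℝ (Fin p) × ℝ) :=
  (multivariateGaussian 0 K).prod (gaussianReal 0 v)

lemma indepFun_euclMul_inner (hK : K.PosSemidef) {A : Matrix (Fin q) (Fin p) ℝ}
    {w : EuclideanSpace ℝ (Fin p)} (h : euclMul A (euclMul K w) = 0) :
    IndepFun (euclMul A) (fun x => inner ℝ x w) (multivariateGaussian 0 K) := by
  let L := (LinearMap.toContinuousLinearMap (Matrix.toLpLin 2 2 A)).prod (innerSL ℝ w)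
  have hL : HasGaussianLaw (fun x => (euclMul A x, inner ℝ w x)) (multivariateGaussian 0 K) :=
    IsGaussian.hasGaussianLaw_id.map L
  have hcov (y : EuclideanSpace ℝ (Fin q)) (c : ℝ) :
      cov[fun x => inner ℝ y (euclMul A x), fun x => inner ℝ c (inner ℝ w x);
        multivariateGaussian 0 K] = 0 := by
    have hy : (fun x => inner ℝ y (euclMul A x)) =
        (innerSL ℝ (euclMul Aᵀ y) : EuclideanSpace ℝ (Fin p) → ℝ) := by
      ext x
      rw [real_inner_comm, inner_euclMul, real_inner_comm, innerSL_apply_apply]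
    have hc : (fun x => inner ℝ c (inner ℝ w x)) = fun x => inner ℝ w x * c := by
      ext x; simp
    rw [hy, hc, covariance_mul_const_right, covariance_dual_multivariateGaussian 0 hK,
      innerSL_apply_apply, inner_euclMul, transpose_transpose, h, inner_zero_right, zero_mul]
  simp_rw [real_inner_comm w]
  exact hL.indepFun_of_covariance_inner hcov

lemma regressionLaw_map_euclMul_inner_add (hK : K.PosSemidef) {A : Matrix (Fin q) (Fin p) ℝ}
    {w : EuclideanSpace ℝ (Fin p)} (h : euclMul A (euclMul K w) = 0) (v : NNReal) :
    (regressionLaw K v).map (fun z => (euclMul A z.1, inner ℝ z.1 w + z.2)) =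
      regressionLaw (A * K * Aᵀ) ((inner ℝ w (euclMul K w)).toNNReal + v) := by
  set ρ := gaussianReal 0 (inner ℝ w (euclMul K w)).toNNReal with hρ
  have hzero : euclMul A 0 = 0 := by simp [euclMul]
  have hsignal : (multivariateGaussian 0 K).map (fun x => (euclMul A x, inner ℝ x w)) =
      (multivariateGaussian 0 (A * K * Aᵀ)).prod ρ := by
    rw [(indepFun_euclMul_inner hK h).map_prod_eq_prod_map_map (by fun_prop) (by fun_prop),
      multivariateGaussian_map_euclMul A 0 hK, multivariateGaussian_map_inner 0 hK, hzero,
      inner_zero_left, ← euclMul_apply, ← real_inner_eq_dotProduct]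
  calc (regressionLaw K v).map (fun z => (euclMul A z.1, inner ℝ z.1 w + z.2))
      = ((((multivariateGaussian 0 K).map fun x => (euclMul A x, inner ℝ x w)).prod
          ((gaussianReal 0 v).map id)).map MeasurableEquiv.prodAssoc).map
            (Prod.map id fun t => t.1 + t.2) := by
        rw [Measure.map_prod_map _ _ (by fun_prop) (by fun_prop), Measure.map_map (by fun_prop)
          (by fun_prop), Measure.map_map (by fun_prop) (by fun_prop)]
        rfl
    _ = (multivariateGaussian 0 (A * K * Aᵀ)).prod ((ρ.prod (gaussianReal 0 v)).map
          fun t => t.1 + t.2) := by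
        rw [hsignal, Measure.map_id, Measure.prodAssoc_prod,
          ← Measure.map_prod_map _ _ (by fun_prop) (by fun_prop), Measure.map_id]
    _ = _ := by
        rw [← Measure.conv, hρ, gaussianReal_conv_gaussianReal, zero_add]

section Moments

variable {v : NNReal}

lemma hasLaw_fst_regressionLaw :
    HasLaw Prod.fst (multivariateGaussian 0 K) (regressionLaw K v) :=
  ⟨measurable_fst.aemeasurable, Measure.fst_prod⟩

lemma memLp_noise_mul_inner (y : EuclideanSpace ℝ (Fin p)) :
    MemLp (fun z => z.2 * inner ℝ z.1 y) 4 (regressionLaw K v) := by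
  have := holderTriple_eight_eight_four
  have hnoise : MemLp (fun z => z.2) 8 (regressionLaw K v) :=
    IsGaussian.memLp_dual (regressionLaw K v)
      (ContinuousLinearMap.snd ℝ (EuclideanSpace ℝ (Fin p)) ℝ) 8 (by simp)
  have hfeature : MemLp (fun z => inner ℝ z.1 y) 8 (regressionLaw K v) := by
    simp_rw [fun z : EuclideanSpace ℝ (Fin p) × ℝ => real_inner_comm y z.1]
    exact IsGaussian.memLp_dual (regressionLaw K v)
      ((innerSL ℝ y).comp (ContinuousLinearMap.fst ℝ (EuclideanSpace ℝ (Fin p)) ℝ)) 8 (by simp)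
  exact hfeature.mul' hnoise

lemma memLp_noise_sq : MemLp (fun z => z.2 ^ 2) 4 (regressionLaw K v) := by
  have := holderTriple_eight_eight_four
  have hnoise : MemLp (fun z => z.2) 8 (regressionLaw K v) :=
    IsGaussian.memLp_dual (regressionLaw K v)
      (ContinuousLinearMap.snd ℝ (EuclideanSpace ℝ (Fin p)) ℝ) 8 (by simp)
  simpa only [pow_two] using hnoise.mul' hnoise

lemma integral_noise_mul_inner (y : EuclideanSpace ℝ (Fin p)) :
    ∫ z, z.2 * inner ℝ z.1 y ∂(regressionLaw K v) = 0 := by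
  calc ∫ z, z.2 * inner ℝ z.1 y ∂(regressionLaw K v)
      = ∫ z, inner ℝ z.1 y * z.2 ∂(regressionLaw K v) := by congr with z; exact mul_comm _ _
    _ = 0 := by
      rw [integral_prod_mul (fun x => inner ℝ x y) (fun e => e), integral_id_gaussianReal,
        mul_zero]

lemma integral_sq_gaussianReal_zero : ∫ e, e ^ 2 ∂(gaussianReal 0 v) = v := by
  have hvar := variance_eq_integral (μ := gaussianReal 0 v) aemeasurable_id
  simpa only [id, integral_id_gaussianReal, sub_zero, variance_id_gaussianReal] using hvar.symm

lemma integral_noise_sq : ∫ z, z.2 ^ 2 ∂(regressionLaw K v) = v := by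
  rw [integral_fun_snd (fun e : ℝ => e ^ 2), integral_sq_gaussianReal_zero]
  simp

lemma integral_noise_mul_inner_sq (hK : K.PosSemidef) (y : EuclideanSpace ℝ (Fin p)) :
    ∫ z, (z.2 * inner ℝ z.1 y) ^ 2 ∂(regressionLaw K v) = v * inner ℝ y (euclMul K y) := by
  have hsignal : ∫ x, inner ℝ x y ^ 2 ∂(multivariateGaussian 0 K) = inner ℝ y (euclMul K y) := by
    rw [← integral_map (f := fun t : ℝ => t ^ 2) (by fun_prop) (by fun_prop),
      multivariateGaussian_map_inner 0 hK, inner_zero_left, integral_sq_gaussianReal_zero,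
      Real.coe_toNNReal _ (by simpa using hK.dotProduct_mulVec_nonneg y.ofLp),
      real_inner_eq_dotProduct, euclMul_apply]
  calc ∫ z, (z.2 * inner ℝ z.1 y) ^ 2 ∂(regressionLaw K v)
      = ∫ z, inner ℝ z.1 y ^ 2 * z.2 ^ 2 ∂(regressionLaw K v) := by
        congr with z; rw [mul_pow, mul_comm]
    _ = v * inner ℝ y (euclMul K y) := by
        rw [integral_prod_mul (fun x => inner ℝ x y ^ 2) (fun e => e ^ 2), hsignal,
          integral_sq_gaussianReal_zero, mul_comm]

end Moments

section Samples

variable {Ω : Type*} [MeasurableSpace Ω] {P : Measure Ω} {v : NNReal}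

lemma ae_tendsto_mean_score [IsProbabilityMeasure P]
    {Z : (n : ℕ) → Fin n → Ω → EuclideanSpace ℝ (Fin p) × ℝ}
    (hlaw : ∀ n k, HasLaw (Z n k) (regressionLaw K v) P) (hind : ∀ n, iIndepFun (Z n) P) :
    ∀ᵐ ω ∂P, Tendsto (fun n : ℕ => (n : ℝ)⁻¹ • ∑ k, (Z n k ω).2 • (Z n k ω).1) atTop (nhds 0) := by
  have hcoord (a : Fin p) : ∀ᵐ ω ∂P, Tendsto (fun n : ℕ => (n : ℝ)⁻¹ *
      ∑ k, (Z n k ω).2 * inner ℝ (Z n k ω).1 (EuclideanSpace.single a 1)) atTop (nhds 0) := by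
    rw [← integral_noise_mul_inner (K := K) (v := v) (EuclideanSpace.single a 1)]
    exact ae_tendsto_rowMean hlaw hind (by fun_prop) (memLp_noise_mul_inner _)
  filter_upwards [ae_all_iff.2 hcoord] with ω hω
  refine ((PiLp.continuous_toLp 2 _).tendsto 0).comp (tendsto_pi_nhds.2 fun a => ?_)
  simpa [EuclideanSpace.inner_single_right] using hω a

lemma integral_norm_score_sq [IsProbabilityMeasure P] (hK : K.PosSemidef) {n : ℕ}
    {Z : Fin n → Ω → EuclideanSpace ℝ (Fin p) × ℝ}
    (hlaw : ∀ k, HasLaw (Z k) (regressionLaw K v) P) (hind : iIndepFun Z P) :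
    Integrable (fun ω => ‖∑ k, (Z k ω).2 • (Z k ω).1‖ ^ 2) P ∧
      ∫ ω, ‖∑ k, (Z k ω).2 • (Z k ω).1‖ ^ 2 ∂P = n * (v * K.trace) := by
  let f (a : Fin p) (z : EuclideanSpace ℝ (Fin p) × ℝ) : ℝ :=
    z.2 * inner ℝ z.1 (EuclideanSpace.single a 1)
  have hfm (a : Fin p) : Measurable (f a) := by fun_prop
  have hmem (a : Fin p) (k : Fin n) : MemLp (fun ω => f a (Z k ω)) 2 P :=
    have hmap : MemLp (f a) 2 (P.map (Z k)) := by
      rw [(hlaw k).map_eq]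
      exact (memLp_noise_mul_inner _).mono_exponent (by norm_num)
    hmap.comp_of_map (hlaw k).aemeasurable
  have hnorm (ω : Ω) : ‖∑ k, (Z k ω).2 • (Z k ω).1‖ ^ 2 = ∑ a, (∑ k, f a (Z k ω)) ^ 2 := by
    simp [EuclideanSpace.real_norm_sq_eq, f, EuclideanSpace.inner_single_right]
  have hint (a : Fin p) : Integrable (fun ω => (∑ k, f a (Z k ω)) ^ 2) P :=
    (memLp_finsetSum _ fun k _ => hmem a k).integrable_sq
  have hcoord (a : Fin p) : ∫ ω, (∑ k, f a (Z k ω)) ^ 2 ∂P = n * (v * K a a) := by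
    have hmean (k : Fin n) : ∫ ω, f a (Z k ω) ∂P = 0 :=
      ((hlaw k).integral_comp (hfm a).aestronglyMeasurable).trans (integral_noise_mul_inner _)
    have hvar (k : Fin n) : ∫ ω, f a (Z k ω) ^ 2 ∂P = v * K a a :=
      ((hlaw k).integral_comp ((hfm a).pow_const 2).aestronglyMeasurable).trans
        ((integral_noise_mul_inner_sq hK _).trans (by
          simp [real_inner_eq_dotProduct, euclMul_apply]))
    have hsum := integral_sum_sq_of_iIndepFun (hind.comp (fun _ => f a) fun _ => hfm a) (hmem a)
      hmean Finset.univ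
    simpa [hvar] using hsum
  simp_rw [hnorm]
  refine ⟨integrable_finsetSum _ fun a _ => hint a, ?_⟩
  rw [integral_finsetSum _ fun a _ => hint a]
  simp_rw [hcoord]
  rw [← Finset.mul_sum, ← Finset.mul_sum, trace]
  rfl

end Samples

end GaussianRegression

section MatrixLimits

variable {p q r : ℕ}

lemma tendsto_euclMul {A : ℕ → Matrix (Fin p) (Fin q) ℝ} {B : Matrix (Fin p) (Fin q) ℝ}
    (hA : Tendsto A atTop (nhds B)) {x : ℕ → EuclideanSpace ℝ (Fin q)}
    {y : EuclideanSpace ℝ (Fin q)} (hx : Tendsto x atTop (nhds y)) :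
    Tendsto (fun n => euclMul (A n) (x n)) atTop (nhds (euclMul B y)) := by
  have hcont : Continuous fun z : Matrix (Fin p) (Fin q) ℝ × EuclideanSpace ℝ (Fin q) =>
      euclMul z.1 z.2 := by
    unfold euclMul
    fun_prop
  exact (hcont.tendsto (B, y)).comp (hA.prodMk_nhds hx)

lemma tendsto_matrix_mul {A : ℕ → Matrix (Fin p) (Fin q) ℝ} {B : Matrix (Fin p) (Fin q) ℝ}
    (hA : Tendsto A atTop (nhds B)) {A' : ℕ → Matrix (Fin q) (Fin r) ℝ}
    {B' : Matrix (Fin q) (Fin r) ℝ} (hA' : Tendsto A' atTop (nhds B')) :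
    Tendsto (fun n => A n * A' n) atTop (nhds (B * B')) :=
  ((continuous_fst.matrix_mul continuous_snd).tendsto (B, B')).comp (hA.prodMk_nhds hA')

lemma tendsto_matrix_inv {A : ℕ → Matrix (Fin p) (Fin p) ℝ} {B : Matrix (Fin p) (Fin p) ℝ}
    (hA : Tendsto A atTop (nhds B)) (hB : IsUnit B) :
    Tendsto (fun n => (A n)⁻¹) atTop (nhds B⁻¹) := by
  refine (continuousAt_matrix_inv B ?_).tendsto.comp hA
  rw [Ring.inverse_eq_inv']
  exact continuousAt_inv₀ ((Matrix.isUnit_iff_isUnit_det B).1 hB).ne_zero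

lemma eventually_isUnit_of_tendsto {A : ℕ → Matrix (Fin p) (Fin p) ℝ}
    {B : Matrix (Fin p) (Fin p) ℝ} (hA : Tendsto A atTop (nhds B)) (hB : IsUnit B) :
    ∀ᶠ n in atTop, IsUnit (A n) := by
  have hdet : Tendsto (fun n => (A n).det) atTop (nhds B.det) :=
    (continuous_id.matrix_det.tendsto B).comp hA
  filter_upwards [hdet.eventually_ne ((Matrix.isUnit_iff_isUnit_det B).1 hB).ne_zero] with n hn
  rwa [Matrix.isUnit_iff_isUnit_det, isUnit_iff_ne_zero]

lemma tendsto_norm_euclMul_div {A : ℕ → Matrix (Fin p) (Fin q) ℝ}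
    (hA : Tendsto A atTop (nhds 0)) {x : ℕ → EuclideanSpace ℝ (Fin q)} {Q : ℕ → ℝ}
    (hQ : ∀ n, ‖x n‖ ^ 2 ≤ Q n) :
    Tendsto (fun n => ‖euclMul (A n) (x n)‖ / (1 + Q n)) atTop (nhds 0) := by
  let Φ : Matrix (Fin p) (Fin q) ℝ →ₗ[ℝ] EuclideanSpace ℝ (Fin q) →L[ℝ] EuclideanSpace ℝ (Fin p) :=
    LinearMap.toContinuousLinearMap.toLinearMap ∘ₗ (Matrix.toLpLin 2 2).toLinearMap
  have hΦ : Tendsto (fun n => ‖Φ (A n)‖) atTop (nhds 0) := by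
    simpa [Function.comp_def] using ((Φ.continuous_of_finiteDimensional.norm).tendsto 0).comp hA
  have hQ0 (n : ℕ) : 0 ≤ Q n := (sq_nonneg _).trans (hQ n)
  refine squeeze_zero (fun n => div_nonneg (norm_nonneg _) (by linarith [hQ0 n])) (fun n => ?_) hΦ
  rw [div_le_iff₀ (by linarith [hQ0 n])]
  calc ‖euclMul (A n) (x n)‖ = ‖Φ (A n) (x n)‖ := rfl
    _ ≤ ‖Φ (A n)‖ * ‖x n‖ := (Φ (A n)).le_opNorm (x n)
    _ ≤ ‖Φ (A n)‖ * (1 + Q n) := by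
      gcongr
      nlinarith [hQ n, sq_nonneg (‖x n‖ - 1)]

end MatrixLimits

section LeastSquares

variable {p : ℕ}

lemma inner_euclMul_designGram {n : ℕ} (X : Fin n → EuclideanSpace ℝ (Fin p))
    (y : EuclideanSpace ℝ (Fin p)) :
    inner ℝ y (euclMul (designGram X) y) = ∑ k, inner ℝ (X k) y ^ 2 := by
  rw [← euclMul_euclMul, ← transpose_transpose (designMatrix X), ← inner_euclMul,
    real_inner_eq_dotProduct]
  simp [euclMul_apply, mulVec, dotProduct, real_inner_eq_dotProduct, pow_two]

lemma sum_sq_olsEstimate_sub {n : ℕ} {X : Fin n → EuclideanSpace ℝ (Fin p)}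
    (hX : (designGram X).PosDef) (β : EuclideanSpace ℝ (Fin p)) (e : Fin n → ℝ) :
    ∑ k, (inner ℝ (X k) (olsEstimate (designMatrix X) fun k => inner ℝ (X k) β + e k) -
        (inner ℝ (X k) β + e k)) ^ 2 =
      ∑ k, e k ^ 2 - inner ℝ (∑ k, e k • X k) (euclMul (designGram X)⁻¹ (∑ k, e k • X k)) := by
  set s := ∑ k, e k • X k with hs
  set r := euclMul (designGram X)⁻¹ s with hr
  have hGr : euclMul (designGram X) r = s := by
    rw [hr, euclMul_euclMul, mul_nonsing_inv _ ((isUnit_iff_isUnit_det _).1 hX.isUnit), euclMul_one]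
  have hquad : ∑ k, inner ℝ (X k) r ^ 2 = inner ℝ s r := by
    rw [← inner_euclMul_designGram, hGr, real_inner_comm]
  have hcross : ∑ k, e k * inner ℝ (X k) r = inner ℝ s r := by
    simp_rw [hs, sum_inner, real_inner_smul_left]
  calc ∑ k, (inner ℝ (X k) (olsEstimate (designMatrix X) fun k => inner ℝ (X k) β + e k) -
        (inner ℝ (X k) β + e k)) ^ 2
      = ∑ k, (inner ℝ (X k) r ^ 2 - 2 * (e k * inner ℝ (X k) r) + e k ^ 2) := by
        refine Finset.sum_congr rfl fun k _ => ?_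
        rw [olsEstimate_inner_add hX, inner_add_right]
        ring
    _ = ∑ k, e k ^ 2 - inner ℝ s r := by
        rw [Finset.sum_add_distrib, Finset.sum_sub_distrib, ← Finset.mul_sum, hquad, hcross]
        ring

lemma euclMul_inv_smul_inv_smul {c : ℝ} (hc : c ≠ 0) {G : Matrix (Fin p) (Fin p) ℝ}
    (hG : IsUnit G) (x : EuclideanSpace ℝ (Fin p)) :
    euclMul (c • G)⁻¹ (c • x) = euclMul G⁻¹ x := by
  have hinv : (c • G)⁻¹ = c⁻¹ • G⁻¹ := by
    have := invertibleOfNonzero hc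
    simpa using Matrix.inv_smul (A := G) c ((isUnit_iff_isUnit_det G).1 hG)
  rw [hinv, smul_euclMul, euclMul_smul, inv_smul_smul₀ hc]

lemma tendsto_mean_sq_olsEstimate_sub {X : (n : ℕ) → Fin n → EuclideanSpace ℝ (Fin p)}
    {e : (n : ℕ) → Fin n → ℝ} {A : Matrix (Fin p) (Fin p) ℝ} (hA : A.PosDef) {v : ℝ}
    (hX : Tendsto (fun n : ℕ => (n : ℝ)⁻¹ • designGram (X n)) atTop (nhds A))
    (hs : Tendsto (fun n : ℕ => (n : ℝ)⁻¹ • ∑ k, e n k • X n k) atTop (nhds 0))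
    (he : Tendsto (fun n : ℕ => (n : ℝ)⁻¹ * ∑ k, e n k ^ 2) atTop (nhds v))
    (β : EuclideanSpace ℝ (Fin p)) :
    Tendsto (fun n : ℕ => (n : ℝ)⁻¹ * ∑ k,
      (inner ℝ (X n k) (olsEstimate (designMatrix (X n)) fun k => inner ℝ (X n k) β + e n k) -
        (inner ℝ (X n k) β + e n k)) ^ 2) atTop (nhds v) := by
  have hlim := he.sub (hs.inner (tendsto_euclMul (tendsto_matrix_inv hX hA.isUnit) hs) (𝕜 := ℝ))
  rw [inner_zero_left, sub_zero] at hlim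
  refine hlim.congr' ?_
  filter_upwards [eventually_posDef_designGram hA hX, eventually_ne_atTop 0] with n hG hn
  rw [sum_sq_olsEstimate_sub hG, euclMul_inv_smul_inv_smul (by positivity) hG.isUnit,
    real_inner_smul_left, mul_sub]

end LeastSquares

lemma eq_zero_of_forall_quadratic_nonneg {b q : ℝ} (h : ∀ t : ℝ, 0 ≤ 2 * t * b + t ^ 2 * q) :
    b = 0 := by
  have hdiscrim : discrim q (2 * b) 0 ≤ 0 := discrim_le_zero fun t => by linarith [h t]
  rw [discrim] at hdiscrim
  nlinarith

namespace Views

variable {m d : ℕ} (V : Views m d) {S : Matrix (Fin d) (Fin d) ℝ} {σ : ℝ}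

/-- The selection matrix `Π_{i+}` of the features which agent `i` observes. -/
def selection (i : Fin m) : Matrix (Fin (V.obs i)) (Fin d) ℝ :=
  (1 : Matrix (Fin d) (Fin d) ℝ).submatrix (fun a => V.view i (Sum.inl a)) id

lemma euclMul_selection (i : Fin m) (x : EuclideanSpace ℝ (Fin d)) :
    euclMul (V.selection i) x = V.plus i x := by
  ext a
  simp [euclMul, selection, plus, mulVec, dotProduct, one_apply]

lemma selection_mul_mul_transpose (S : Matrix (Fin d) (Fin d) ℝ) (i : Fin m) :
    V.selection i * S * (V.selection i)ᵀ = V.blockPP i S := by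
  ext a b
  simp [selection, blockPP, mul_apply, one_apply]

lemma blockPP_mul_transfer (hS : S.PosDef) (i : Fin m) :
    V.blockPP i S * V.transfer S i = V.selection i * S := by
  have hdet : IsUnit (V.blockPP i S).det :=
    (isUnit_iff_isUnit_det _).1 (V.blockPP_posDef hS i).isUnit
  have hcols : V.blockPP i S * fromCols 1 ((V.blockPP i S)⁻¹ * V.blockPM i S) =
      fromCols (V.blockPP i S) (V.blockPM i S) := by
    rw [mul_fromCols, Matrix.mul_one, ← Matrix.mul_assoc, mul_nonsing_inv _ hdet, Matrix.one_mul]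
  calc V.blockPP i S * V.transfer S i
      = (fromCols (V.blockPP i S) (V.blockPM i S)).submatrix id (V.view i).symm := by
        rw [← hcols]; rfl
    _ = V.selection i * S := by
        ext a b
        obtain ⟨b, rfl⟩ := (V.view i).surjective b
        cases b <;> simp [selection, blockPP, blockPM, mul_apply, one_apply]

/-- The coefficients `θ - Π_{i+}ᵀ T_i θ` of the part of `⟨x, θ⟩` which the observed features do not
predict. -/
noncomputable def residualCoeff (S : Matrix (Fin d) (Fin d) ℝ) (θ : EuclideanSpace ℝ (Fin d))
    (i : Fin m) : EuclideanSpace ℝ (Fin d) :=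
  θ - euclMul (V.selection i)ᵀ (euclMul (V.transfer S i) θ)

lemma inner_residualCoeff (S : Matrix (Fin d) (Fin d) ℝ) (θ x : EuclideanSpace ℝ (Fin d))
    (i : Fin m) :
    inner ℝ x (V.residualCoeff S θ i) =
      inner ℝ x θ - inner ℝ (V.plus i x) (euclMul (V.transfer S i) θ) := by
  rw [residualCoeff, inner_sub_right, ← inner_euclMul, euclMul_selection]

lemma euclMul_selection_euclMul_residualCoeff (hS : S.PosDef) (θ : EuclideanSpace ℝ (Fin d))
    (i : Fin m) : euclMul (V.selection i) (euclMul S (V.residualCoeff S θ i)) = 0 := by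
  rw [residualCoeff, euclMul_sub, euclMul_sub]
  simp only [euclMul_euclMul]
  rw [← Matrix.mul_assoc, ← Matrix.mul_assoc, V.selection_mul_mul_transpose,
    V.blockPP_mul_transfer hS, sub_self]

lemma inner_euclMul_eq_transfer_add_schur (hS : S.PosDef) (θ : EuclideanSpace ℝ (Fin d))
    (i : Fin m) :
    inner ℝ θ (euclMul S θ) =
      inner ℝ (euclMul (V.transfer S i) θ)
        (euclMul (V.blockPP i S) (euclMul (V.transfer S i) θ)) +
      (V.minus i θ).ofLp ⬝ᵥ V.schur S i *ᵥ (V.minus i θ).ofLp := by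
  have hP := V.blockPP_posDef hS i
  have : Invertible (V.blockPP i S) := hP.isUnit.invertible
  have hview : θ.ofLp ∘ V.view i = Sum.elim (V.plus i θ).ofLp (V.minus i θ).ofLp := by
    ext (a | a) <;> rfl
  have hschur := schur_complement_eq₁₁ (V.blockPM i S) (V.blockMM i S) (V.plus i θ).ofLp
    (V.minus i θ).ofLp hP.isHermitian
  rw [← V.submatrix_view hS.isHermitian, ← hview] at hschur
  have hquad : (θ.ofLp ∘ V.view i) ⬝ᵥ S.submatrix (V.view i) (V.view i) *ᵥ (θ.ofLp ∘ V.view i) =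
      θ.ofLp ⬝ᵥ S *ᵥ θ.ofLp := by
    rw [submatrix_mulVec_equiv, comp_equiv_dotProduct_comp_equiv, Function.comp_assoc,
      Equiv.self_comp_symm, Function.comp_id]
  rw [schur, V.blockMP_eq_transpose hS.isHermitian, euclMul_transfer, real_inner_eq_dotProduct,
    real_inner_eq_dotProduct, euclMul_apply, euclMul_apply, ← hquad]
  simpa [← dotProduct_mulVec, euclMul_apply, mulVec_add, dotProduct_add] using hschur

lemma inner_residualCoeff_euclMul (hS : S.PosDef) (θ : EuclideanSpace ℝ (Fin d)) (i : Fin m) :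
    inner ℝ (V.residualCoeff S θ i) (euclMul S (V.residualCoeff S θ i)) =
      (V.minus i θ).ofLp ⬝ᵥ V.schur S i *ᵥ (V.minus i θ).ofLp := by
  have hST : Sᵀ = S := by simpa [IsHermitian] using hS.isHermitian
  rw [real_inner_comm, inner_residualCoeff, ← euclMul_selection,
    V.euclMul_selection_euclMul_residualCoeff hS, inner_zero_left, sub_zero, real_inner_comm,
    ← hST, ← inner_euclMul, hST, inner_residualCoeff, ← euclMul_selection, euclMul_euclMul,
    ← V.blockPP_mul_transfer hS, ← euclMul_euclMul, real_inner_comm,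
    V.inner_euclMul_eq_transfer_add_schur hS θ i,
    real_inner_comm (euclMul (V.transfer S i) θ), add_sub_cancel_left]

/-- A sample `(x, ξ)` as agent `i` sees it: the observed features `x_{i+}` and the effective noise
`y - ⟨x_{i+}, T_i θ⟩` of the label `y = ⟨x, θ⟩ + ξ`. -/
noncomputable def agentSample (S : Matrix (Fin d) (Fin d) ℝ) (θ : EuclideanSpace ℝ (Fin d))
    (i : Fin m) (z : EuclideanSpace ℝ (Fin d) × ℝ) : EuclideanSpace ℝ (Fin (V.obs i)) × ℝ :=
  (V.plus i z.1, inner ℝ z.1 (V.residualCoeff S θ i) + z.2)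

lemma inner_add_eq_agentSample (S : Matrix (Fin d) (Fin d) ℝ) (θ : EuclideanSpace ℝ (Fin d))
    (i : Fin m) (z : EuclideanSpace ℝ (Fin d) × ℝ) :
    inner ℝ z.1 θ + z.2 =
      inner ℝ (V.plus i z.1) (euclMul (V.transfer S i) θ) + (V.agentSample S θ i z).2 := by
  rw [agentSample, inner_residualCoeff]
  ring

lemma measurable_agentSample (θ : EuclideanSpace ℝ (Fin d)) (i : Fin m) :
    Measurable (V.agentSample S θ i) := by
  unfold agentSample plus
  fun_prop

lemma map_agentSample (hS : S.PosDef) (θ : EuclideanSpace ℝ (Fin d)) (i : Fin m) :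
    (regressionLaw S (σ ^ 2).toNNReal).map (V.agentSample S θ i) =
      regressionLaw (V.blockPP i S) (V.labelVar S σ θ i).toNNReal := by
  have h := regressionLaw_map_euclMul_inner_add hS.posSemidef
    (V.euclMul_selection_euclMul_residualCoeff hS θ i) (σ ^ 2).toNNReal
  rw [V.selection_mul_mul_transpose, V.inner_residualCoeff_euclMul hS,
    ← Real.toNNReal_add (V.schur_quadratic_nonneg hS θ i) (sq_nonneg σ)] at h
  simp only [V.euclMul_selection] at h
  exact h

lemma weightedRisk_add_smul
    {W : (i : Fin m) → Matrix (Fin (V.obs i)) (Fin (V.obs i)) ℝ} (hW : ∀ i, (W i)ᵀ = W i)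
    (z : (i : Fin m) → EuclideanSpace ℝ (Fin (V.obs i))) (ϑ h : EuclideanSpace ℝ (Fin d)) (t : ℝ) :
    V.weightedRisk S W z (ϑ + t • h) = V.weightedRisk S W z ϑ +
      2 * t * inner ℝ h
        (∑ i, euclMul ((V.transfer S i)ᵀ * W i) (euclMul (V.transfer S i) ϑ - z i)) +
      t ^ 2 * ∑ i, inner ℝ (euclMul (V.transfer S i) h)
          (euclMul (W i) (euclMul (V.transfer S i) h)) := by
  rw [inner_sum, Finset.mul_sum, Finset.mul_sum, weightedRisk, weightedRisk,
    ← Finset.sum_add_distrib, ← Finset.sum_add_distrib]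
  refine Finset.sum_congr rfl fun i _ => ?_
  set T := V.transfer S i
  set r := euclMul T ϑ - z i with hr
  set g := euclMul T h with hg
  have hshift : euclMul T (ϑ + t • h) - z i = r + t • g := by
    rw [euclMul_add, euclMul_smul, hr, hg]
    abel
  have hquad (v : EuclideanSpace ℝ (Fin (V.obs i))) :
      v.ofLp ⬝ᵥ W i *ᵥ v.ofLp = inner ℝ v (euclMul (W i) v) := by
    rw [real_inner_eq_dotProduct, euclMul_apply]
  have hcross : inner ℝ h (euclMul (Tᵀ * W i) r) = inner ℝ g (euclMul (W i) r) := by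
    rw [← euclMul_euclMul, hg, inner_euclMul]
  have hsymm : inner ℝ r (euclMul (W i) g) = inner ℝ g (euclMul (W i) r) := by
    rw [real_inner_comm, inner_euclMul, hW]
  rw [hshift, hquad, hquad, hcross, euclMul_add, euclMul_smul]
  simp only [inner_add_left, inner_add_right, real_inner_smul_left, real_inner_smul_right]
  rw [hsymm]
  ring

lemma normal_equation
    {W : (i : Fin m) → Matrix (Fin (V.obs i)) (Fin (V.obs i)) ℝ} (hW : ∀ i, (W i)ᵀ = W i)
    {z : (i : Fin m) → EuclideanSpace ℝ (Fin (V.obs i))} {ϑ : EuclideanSpace ℝ (Fin d)}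
    (h : IsMinOn (V.weightedRisk S W z) Set.univ ϑ) :
    ∑ i, euclMul ((V.transfer S i)ᵀ * W i) (euclMul (V.transfer S i) ϑ - z i) = 0 := by
  set g := ∑ i, euclMul ((V.transfer S i)ᵀ * W i) (euclMul (V.transfer S i) ϑ - z i) with hg
  refine (inner_self_eq_zero (𝕜 := ℝ)).1 (eq_zero_of_forall_quadratic_nonneg
    (q := ∑ i, inner ℝ (euclMul (V.transfer S i) g) (euclMul (W i) (euclMul (V.transfer S i) g)))
    fun t => ?_)
  have hmin : V.weightedRisk S W z ϑ ≤ V.weightedRisk S W z (ϑ + t • g) := h (Set.mem_univ _)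
  rw [V.weightedRisk_add_smul hW, ← hg] at hmin
  linarith

variable {n : ℕ}

/-- The score `∑ k, e_k x_{k,i+}` of agent `i` for the data `z`, where `e_k` is the effective noise
of the `k`-th sample. -/
noncomputable def score (S : Matrix (Fin d) (Fin d) ℝ) (θ : EuclideanSpace ℝ (Fin d)) (i : Fin m)
    (z : Fin n → EuclideanSpace ℝ (Fin d) × ℝ) : EuclideanSpace ℝ (Fin (V.obs i)) :=
  ∑ k, (V.agentSample S θ i (z k)).2 • (V.agentSample S θ i (z k)).1

/-- The Gram matrix of the features which agent `i` observes in the data `z`. -/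
noncomputable abbrev agentGram (i : Fin m) (z : Fin n → EuclideanSpace ℝ (Fin d) × ℝ) :
    Matrix (Fin (V.obs i)) (Fin (V.obs i)) ℝ :=
  designGram fun k => V.plus i (z k).1

lemma localOLS_eq_add_score (θ : EuclideanSpace ℝ (Fin d))
    (z : Fin m → Fin n → EuclideanSpace ℝ (Fin d) × ℝ) {i : Fin m}
    (hG : (V.agentGram i (z i)).PosDef) :
    V.localOLS (fun i k => (z i k).1) (fun i k => inner ℝ (z i k).1 θ + (z i k).2) i =
      euclMul (V.transfer S i) θ + euclMul (V.agentGram i (z i))⁻¹ (V.score S θ i (z i)) := by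
  simp_rw [localOLS, V.inner_add_eq_agentSample S θ i]
  exact olsEstimate_inner_add hG _ _

lemma tendsto_residual (hS : S.PosDef) (θ : EuclideanSpace ℝ (Fin d)) (i : Fin m) {v : ℝ}
    {z : (n : ℕ) → Fin m → Fin n → EuclideanSpace ℝ (Fin d) × ℝ}
    (hG : Tendsto (fun n : ℕ => (n : ℝ)⁻¹ • V.agentGram i (z n i)) atTop
      (nhds (V.blockPP i S)))
    (hs : Tendsto (fun n : ℕ => (n : ℝ)⁻¹ • V.score S θ i (z n i)) atTop (nhds 0))
    (he : Tendsto (fun n : ℕ => (n : ℝ)⁻¹ * ∑ k, (V.agentSample S θ i (z n i k)).2 ^ 2) atTop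
      (nhds v)) :
    Tendsto (fun n => V.residual (fun i k => (z n i k).1)
      (fun i k => inner ℝ (z n i k).1 θ + (z n i k).2) i) atTop (nhds v) := by
  simp_rw [residual, localOLS, V.inner_add_eq_agentSample S θ i]
  exact tendsto_mean_sq_olsEstimate_sub (V.blockPP_posDef hS i) hG hs he _

/-- The matrix `(∑ j, T_jᵀ W_j T_j)⁻¹ T_iᵀ W_i G_i⁻¹`, for the weights `W_j = Σ_{j+} / v_j`, by
which the score of agent `i` enters the error of the weighted least squares estimate. -/
noncomputable def collabGain (S : Matrix (Fin d) (Fin d) ℝ) (v : Fin m → ℝ)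
    (G : (i : Fin m) → Matrix (Fin (V.obs i)) (Fin (V.obs i)) ℝ) (i : Fin m) :
    Matrix (Fin d) (Fin (V.obs i)) ℝ :=
  (∑ j, (V.transfer S j)ᵀ * ((v j)⁻¹ • V.blockPP j S) * V.transfer S j)⁻¹ *
    ((V.transfer S i)ᵀ * ((v i)⁻¹ • V.blockPP i S) * (G i)⁻¹)

lemma IsCollab.sqrt_smul_sub_eq (hS : S.PosDef) {θ : EuclideanSpace ℝ (Fin d)} (hn : n ≠ 0)
    {z : Fin m → Fin n → EuclideanSpace ℝ (Fin d) × ℝ} {ϑ : EuclideanSpace ℝ (Fin d)}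
    (h : V.IsCollab S (fun i k => (z i k).1) (fun i k => inner ℝ (z i k).1 θ + (z i k).2) ϑ)
    (hG : ∀ i, (V.agentGram i (z i)).PosDef) {v : Fin m → ℝ}
    (hv : v = V.residual (fun i k => (z i k).1) (fun i k => inner ℝ (z i k).1 θ + (z i k).2))
    (hM : IsUnit (∑ i, (V.transfer S i)ᵀ * ((v i)⁻¹ • V.blockPP i S) * V.transfer S i)) :
    √(n : ℝ) • (ϑ - θ) =
      ∑ i, euclMul (V.collabGain S v (fun i => (n : ℝ)⁻¹ • V.agentGram i (z i)) i)
        ((√(n : ℝ))⁻¹ • V.score S θ i (z i)) := by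
  set M := ∑ i, (V.transfer S i)ᵀ * ((v i)⁻¹ • V.blockPP i S) * V.transfer S i with hMdef
  have hnormal := V.normal_equation (fun i => by
    rw [transpose_smul]
    congr 1
    simpa [IsHermitian] using (V.blockPP_posDef hS i).isHermitian) h
  have herror : euclMul M (ϑ - θ) = ∑ i, euclMul ((V.transfer S i)ᵀ * ((v i)⁻¹ • V.blockPP i S))
      (euclMul (V.agentGram i (z i))⁻¹ (V.score S θ i (z i))) := by
    rw [hMdef, sum_euclMul, ← sub_eq_zero, ← Finset.sum_sub_distrib, ← hnormal, ← hv]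
    refine Finset.sum_congr rfl fun i _ => ?_
    rw [V.localOLS_eq_add_score (S := S) θ z (hG i)]
    simp only [euclMul_sub, euclMul_add, euclMul_euclMul, Matrix.mul_assoc]
    abel
  have hscale (i : Fin m) : euclMul ((n : ℝ)⁻¹ • V.agentGram i (z i))⁻¹
      ((√(n : ℝ))⁻¹ • V.score S θ i (z i)) =
      √(n : ℝ) • euclMul (V.agentGram i (z i))⁻¹ (V.score S θ i (z i)) := by
    rw [← euclMul_inv_smul_inv_smul (c := (n : ℝ)⁻¹) (by positivity) (hG i).isUnit,
      ← euclMul_smul, smul_smul, ← div_eq_mul_inv, Real.sqrt_div_self', one_div]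
  calc √(n : ℝ) • (ϑ - θ) = √(n : ℝ) • euclMul M⁻¹ (euclMul M (ϑ - θ)) := by
        rw [euclMul_euclMul, nonsing_inv_mul _ ((isUnit_iff_isUnit_det M).1 hM), euclMul_one]
    _ = _ := by
        rw [herror, euclMul_sum, Finset.smul_sum]
        refine Finset.sum_congr rfl fun i _ => ?_
        rw [collabGain, ← hMdef, ← Matrix.mul_assoc, ← euclMul_euclMul _ (_)⁻¹, hscale,
          euclMul_smul, euclMul_euclMul M⁻¹]

lemma tendsto_sum_transfer_mul {v : ℕ → Fin m → ℝ} {θ : EuclideanSpace ℝ (Fin d)}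
    (hS : S.PosDef) (hσ : 0 < σ)
    (hv : ∀ i, Tendsto (fun n => v n i) atTop (nhds (V.labelVar S σ θ i))) :
    Tendsto (fun n => ∑ i, (V.transfer S i)ᵀ * ((v n i)⁻¹ • V.blockPP i S) * V.transfer S i) atTop
      (nhds (V.precision S σ θ)) :=
  tendsto_finsetSum _ fun i _ => tendsto_matrix_mul (tendsto_matrix_mul tendsto_const_nhds
    (((hv i).inv₀ (V.labelVar_pos hS hσ θ i).ne').smul_const _)) tendsto_const_nhds

lemma tendsto_collabGain (hS : S.PosDef) (hσ : 0 < σ) {θ : EuclideanSpace ℝ (Fin d)}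
    (hC : IsUnit (V.precision S σ θ)) {v : ℕ → Fin m → ℝ}
    (hv : ∀ i, Tendsto (fun n => v n i) atTop (nhds (V.labelVar S σ θ i)))
    {G : ℕ → (i : Fin m) → Matrix (Fin (V.obs i)) (Fin (V.obs i)) ℝ}
    (hG : ∀ i, Tendsto (fun n => G n i) atTop (nhds (V.blockPP i S))) (i : Fin m) :
    Tendsto (fun n => V.collabGain S (v n) (G n) i) atTop
      (nhds (V.covG S σ θ * ((V.labelVar S σ θ i)⁻¹ • (V.transfer S i)ᵀ))) := by
  have hK := (V.blockPP_posDef hS i).isUnit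
  have hW := ((hv i).inv₀ (V.labelVar_pos hS hσ θ i).ne').smul_const (V.blockPP i S)
  have hlim := tendsto_matrix_mul (tendsto_matrix_inv (V.tendsto_sum_transfer_mul hS hσ hv) hC)
    (tendsto_matrix_mul (tendsto_matrix_mul (tendsto_const_nhds (x := (V.transfer S i)ᵀ)) hW)
      (tendsto_matrix_inv (hG i) hK))
  rwa [Matrix.mul_assoc (V.transfer S i)ᵀ, smul_mul,
    mul_nonsing_inv _ ((isUnit_iff_isUnit_det _).1 hK), Matrix.mul_smul, Matrix.mul_one] at hlim

/-- The derivative `∑ i, v_i⁻¹ T_iᵀ s_i` at `θ` of the Gaussian log-likelihood of all labels, with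
`s_i` the score and `v_i` the label variance of agent `i`. -/
noncomputable def totalScore (S : Matrix (Fin d) (Fin d) ℝ) (σ : ℝ) (θ : EuclideanSpace ℝ (Fin d))
    (z : Fin m → Fin n → EuclideanSpace ℝ (Fin d) × ℝ) : EuclideanSpace ℝ (Fin d) :=
  ∑ i, (V.labelVar S σ θ i)⁻¹ • euclMul (V.transfer S i)ᵀ (V.score S θ i (z i))

lemma euclMul_covG_totalScore (θ : EuclideanSpace ℝ (Fin d))
    (z : Fin m → Fin n → EuclideanSpace ℝ (Fin d) × ℝ) :
    euclMul (V.covG S σ θ) ((√(n : ℝ))⁻¹ • V.totalScore S σ θ z) =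
      ∑ i, euclMul (V.covG S σ θ * ((V.labelVar S σ θ i)⁻¹ • (V.transfer S i)ᵀ))
        ((√(n : ℝ))⁻¹ • V.score S θ i (z i)) := by
  simp only [totalScore, Finset.smul_sum, euclMul_sum, ← euclMul_euclMul, smul_euclMul,
    euclMul_smul, smul_comm (√(n : ℝ))⁻¹]

lemma tendsto_norm_sqrt_smul_sub_div (hS : S.PosDef) (hσ : 0 < σ) {θ : EuclideanSpace ℝ (Fin d)}
    (hC : IsUnit (V.precision S σ θ)) {z : (n : ℕ) → Fin m → Fin n → EuclideanSpace ℝ (Fin d) × ℝ}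
    {ϑ : ℕ → EuclideanSpace ℝ (Fin d)}
    (hG : ∀ i, Tendsto (fun n : ℕ => (n : ℝ)⁻¹ • V.agentGram i (z n i)) atTop
      (nhds (V.blockPP i S)))
    (hs : ∀ i, Tendsto (fun n : ℕ => (n : ℝ)⁻¹ • V.score S θ i (z n i)) atTop (nhds 0))
    (he : ∀ i, Tendsto (fun n : ℕ => (n : ℝ)⁻¹ * ∑ k, (V.agentSample S θ i (z n i k)).2 ^ 2) atTop
      (nhds (V.labelVar S σ θ i)))
    (hϑ : ∀ n, V.IsCollab S (fun i k => (z n i k).1)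
      (fun i k => inner ℝ (z n i k).1 θ + (z n i k).2) (ϑ n)) :
    Tendsto (fun n : ℕ => ‖√(n : ℝ) • (ϑ n - θ) -
        euclMul (V.covG S σ θ) ((√(n : ℝ))⁻¹ • V.totalScore S σ θ (z n))‖ /
      (1 + ∑ i, ‖(√(n : ℝ))⁻¹ • V.score S θ i (z n i)‖ ^ 2)) atTop (nhds 0) := by
  set v : ℕ → Fin m → ℝ := fun n => V.residual (fun i k => (z n i k).1)
    (fun i k => inner ℝ (z n i k).1 θ + (z n i k).2)
  have hv (i : Fin m) : Tendsto (fun n => v n i) atTop (nhds (V.labelVar S σ θ i)) :=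
    V.tendsto_residual hS θ i (hG i) (hs i) (he i)
  let Δ (n : ℕ) (i : Fin m) : Matrix (Fin d) (Fin (V.obs i)) ℝ :=
    V.collabGain S (v n) (fun i => (n : ℝ)⁻¹ • V.agentGram i (z n i)) i -
      V.covG S σ θ * ((V.labelVar S σ θ i)⁻¹ • (V.transfer S i)ᵀ)
  let s (n : ℕ) (i : Fin m) : EuclideanSpace ℝ (Fin (V.obs i)) :=
    (√(n : ℝ))⁻¹ • V.score S θ i (z n i)
  have hΔ (i : Fin m) : Tendsto (fun n => Δ n i) atTop (nhds 0) :=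
    tendsto_sub_nhds_zero_iff.2 (V.tendsto_collabGain hS hσ hC hv hG i)
  have hsum : Tendsto (fun n => ∑ i, ‖euclMul (Δ n i) (s n i)‖ / (1 + ∑ j, ‖s n j‖ ^ 2)) atTop
      (nhds 0) := by
    rw [← Finset.sum_const_zero (s := Finset.univ (α := Fin m))]
    refine tendsto_finsetSum _ fun i _ => tendsto_norm_euclMul_div (hΔ i) fun n => ?_
    exact Finset.single_le_sum (f := fun j => ‖s n j‖ ^ 2) (fun _ _ => sq_nonneg _)
      (Finset.mem_univ i)
  have herror : ∀ᶠ n : ℕ in atTop, √(n : ℝ) • (ϑ n - θ) -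
      euclMul (V.covG S σ θ) ((√(n : ℝ))⁻¹ • V.totalScore S σ θ (z n)) =
      ∑ i, euclMul (Δ n i) (s n i) := by
    filter_upwards [eventually_ne_atTop 0, eventually_all.2 fun i =>
      eventually_posDef_designGram (V.blockPP_posDef hS i) (hG i),
      eventually_isUnit_of_tendsto (V.tendsto_sum_transfer_mul hS hσ hv) hC] with n hn hGn hM
    rw [IsCollab.sqrt_smul_sub_eq V hS hn (hϑ n) hGn rfl hM, V.euclMul_covG_totalScore,
      ← Finset.sum_sub_distrib]
    simp only [Δ, s, sub_euclMul]
    rfl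
  refine squeeze_zero' (Eventually.of_forall fun n => by positivity) ?_ hsum
  filter_upwards [herror] with n hn
  rw [hn, ← Finset.sum_div]
  gcongr
  exact norm_sum_le _ _

end Views

namespace IsGaussianData

variable {m d : ℕ} (V : Views m d) {S : Matrix (Fin d) (Fin d) ℝ} {σ : ℝ}
  {θ : EuclideanSpace ℝ (Fin d)} {Ω : Type*} [MeasurableSpace Ω] {P : Measure Ω}
  {x : (n : ℕ) → Fin m → Fin n → Ω → EuclideanSpace ℝ (Fin d)}
  {ξ : (n : ℕ) → Fin m → Fin n → Ω → ℝ}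

lemma hasLaw_agentSample (h : IsGaussianData S σ x ξ P) (hS : S.PosDef)
    (θ : EuclideanSpace ℝ (Fin d)) (n : ℕ) (i : Fin m) (k : Fin n) :
    HasLaw (fun ω => V.agentSample S θ i (x n i k ω, ξ n i k ω))
      (regressionLaw (V.blockPP i S) (V.labelVar S σ θ i).toNNReal) P where
  aemeasurable := (V.measurable_agentSample θ i).comp_aemeasurable (h.law n i k).aemeasurable
  map_eq := by
    rw [← V.map_agentSample hS θ i, regressionLaw, ← (h.law n i k).map_eq,
      AEMeasurable.map_map_of_aemeasurable (V.measurable_agentSample θ i).aemeasurable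
        (h.law n i k).aemeasurable]
    rfl

lemma iIndepFun_agentSample (h : IsGaussianData S σ x ξ P) (S' : Matrix (Fin d) (Fin d) ℝ)
    (θ : EuclideanSpace ℝ (Fin d)) (n : ℕ) :
    iIndepFun (fun (q : Fin m × Fin n) ω =>
      V.agentSample S' θ q.1 (x n q.1 q.2 ω, ξ n q.1 q.2 ω)) P :=
  (h.indep n).comp (fun q => V.agentSample S' θ q.1) fun q => V.measurable_agentSample θ q.1

lemma iIndepFun_agentSample_row (h : IsGaussianData S σ x ξ P) (S' : Matrix (Fin d) (Fin d) ℝ)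
    (θ : EuclideanSpace ℝ (Fin d)) (n : ℕ) (i : Fin m) :
    iIndepFun (fun k ω => V.agentSample S' θ i (x n i k ω, ξ n i k ω)) P :=
  (h.iIndepFun_agentSample V S' θ n).precomp (g := fun k => (i, k))
    fun _ _ hk => (Prod.ext_iff.1 hk).2

variable [IsProbabilityMeasure P]

lemma ae_tendsto_agentGram (h : IsGaussianData S σ x ξ P) (hS : S.PosDef) (i : Fin m) :
    ∀ᵐ ω ∂P, Tendsto (fun n : ℕ => (n : ℝ)⁻¹ • V.agentGram i fun k => (x n i k ω, ξ n i k ω)) atTop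
      (nhds (V.blockPP i S)) :=
  ae_tendsto_designGram (V.blockPP_posDef hS i).posSemidef
    (fun n k => hasLaw_fst_regressionLaw.comp (h.hasLaw_agentSample V hS 0 n i k))
    fun n => (h.iIndepFun_agentSample_row V S 0 n i).comp (fun _ => Prod.fst)
      fun _ => measurable_fst

lemma ae_tendsto_score (h : IsGaussianData S σ x ξ P) (hS : S.PosDef)
    (θ : EuclideanSpace ℝ (Fin d)) (i : Fin m) :
    ∀ᵐ ω ∂P, Tendsto (fun n : ℕ => (n : ℝ)⁻¹ • V.score S θ i fun k => (x n i k ω, ξ n i k ω)) atTop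
      (nhds 0) :=
  ae_tendsto_mean_score (fun n k => h.hasLaw_agentSample V hS θ n i k)
    fun n => h.iIndepFun_agentSample_row V S θ n i

lemma ae_tendsto_mean_noise_sq (h : IsGaussianData S σ x ξ P) (hS : S.PosDef) (hσ : 0 < σ)
    (θ : EuclideanSpace ℝ (Fin d)) (i : Fin m) :
    ∀ᵐ ω ∂P, Tendsto (fun n : ℕ =>
      (n : ℝ)⁻¹ * ∑ k, (V.agentSample S θ i (x n i k ω, ξ n i k ω)).2 ^ 2) atTop
      (nhds (V.labelVar S σ θ i)) := by
  have hmean := ae_tendsto_rowMean (fun n k => h.hasLaw_agentSample V hS θ n i k)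
    (fun n => h.iIndepFun_agentSample_row V S θ n i) (measurable_snd.pow_const 2) memLp_noise_sq
  rwa [integral_noise_sq, Real.coe_toNNReal _ (V.labelVar_pos hS hσ θ i).le] at hmean

lemma integral_sum_norm_score_sq_le (h : IsGaussianData S σ x ξ P) (hS : S.PosDef) (hσ : 0 < σ)
    (θ : EuclideanSpace ℝ (Fin d)) (n : ℕ) :
    Integrable (fun ω =>
        ∑ i, ‖(√(n : ℝ))⁻¹ • V.score S θ i fun k => (x n i k ω, ξ n i k ω)‖ ^ 2) P ∧
      ∫ ω, ∑ i, ‖(√(n : ℝ))⁻¹ • V.score S θ i fun k => (x n i k ω, ξ n i k ω)‖ ^ 2 ∂P ≤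
        ∑ i, V.labelVar S σ θ i * (V.blockPP i S).trace := by
  have hscore (i : Fin m) := integral_norm_score_sq (V.blockPP_posDef hS i).posSemidef
    (fun k => h.hasLaw_agentSample V hS θ n i k) (h.iIndepFun_agentSample_row V S θ n i)
  simp_rw [norm_smul, mul_pow, Real.norm_eq_abs, sq_abs, inv_pow, Real.sq_sqrt (Nat.cast_nonneg n)]
  have hint (i : Fin m) : Integrable
      (fun ω => (n : ℝ)⁻¹ * ‖V.score S θ i fun k => (x n i k ω, ξ n i k ω)‖ ^ 2) P :=
    (hscore i).1.const_mul _
  refine ⟨integrable_finsetSum _ fun i _ => hint i, ?_⟩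
  rw [integral_finsetSum _ fun i _ => hint i]
  refine Finset.sum_le_sum fun i _ => ?_
  have hv := (V.labelVar_pos hS hσ θ i).le
  calc ∫ ω, (n : ℝ)⁻¹ * ‖V.score S θ i fun k => (x n i k ω, ξ n i k ω)‖ ^ 2 ∂P
      = (n : ℝ)⁻¹ * (n * (V.labelVar S σ θ i * (V.blockPP i S).trace)) := by
        rw [integral_const_mul, ← Real.coe_toNNReal _ hv]
        exact congrArg _ (hscore i).2
    _ ≤ V.labelVar S σ θ i * (V.blockPP i S).trace :=
        inv_mul_le_of_le_mul₀ (Nat.cast_nonneg n)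
          (mul_nonneg hv (V.blockPP_posDef hS i).posSemidef.trace_nonneg) le_rfl

lemma tendstoInDistribution_totalScore (h : IsGaussianData S σ x ξ P) (hS : S.PosDef) (hσ : 0 < σ)
    (θ : EuclideanSpace ℝ (Fin d)) :
    TendstoInDistribution (fun (n : ℕ) ω =>
      (√(n : ℝ))⁻¹ • V.totalScore S σ θ fun i k => (x n i k ω, ξ n i k ω)) atTop id
      (fun _ => P) (multivariateGaussian 0 (V.precision S σ θ)) := by
  let F (i : Fin m) (z : EuclideanSpace ℝ (Fin (V.obs i)) × ℝ) : EuclideanSpace ℝ (Fin d) :=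
    (V.labelVar S σ θ i)⁻¹ • euclMul (V.transfer S i)ᵀ (z.2 • z.1)
  have hF (i : Fin m) : Measurable (F i) := by fun_prop
  have hinner (i : Fin m) (z : EuclideanSpace ℝ (Fin (V.obs i)) × ℝ)
      (t : EuclideanSpace ℝ (Fin d)) :
      inner ℝ (F i z) t =
        (V.labelVar S σ θ i)⁻¹ * (z.2 * inner ℝ z.1 (euclMul (V.transfer S i) t)) := by
    rw [real_inner_smul_left, inner_euclMul, transpose_transpose, real_inner_smul_left]
  have hcov (t : EuclideanSpace ℝ (Fin d)) :
      ∑ i, ∫ z, inner ℝ (F i z) t ^ 2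
          ∂(regressionLaw (V.blockPP i S) (V.labelVar S σ θ i).toNNReal) =
        inner ℝ t (euclMul (V.precision S σ θ) t) := by
    rw [V.inner_euclMul_precision]
    refine Finset.sum_congr rfl fun i _ => ?_
    simp_rw [hinner, mul_pow (V.labelVar S σ θ i)⁻¹]
    rw [integral_const_mul, integral_noise_mul_inner_sq (V.blockPP_posDef hS i).posSemidef,
      Real.coe_toNNReal _ (V.labelVar_pos hS hσ θ i).le]
    have := (V.labelVar_pos hS hσ θ i).ne'
    field_simp
  have hclt := tendstoInDistribution_rowSum (F := F)
    (fun n q => h.hasLaw_agentSample V hS θ n q.1 q.2) (h.iIndepFun_agentSample V S θ) hF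
    (fun i t => by
      simp_rw [hinner]
      exact ((memLp_noise_mul_inner _).mono_exponent (by norm_num)).const_mul _)
    (fun i t => by simp_rw [hinner, integral_const_mul, integral_noise_mul_inner, mul_zero])
    (V.precision_posSemidef hS hσ θ) hcov
  convert hclt using 4 with n ω
  simp only [Views.totalScore, Views.score, F, Fintype.sum_prod_type, euclMul_sum,
    Finset.smul_sum]

lemma tendstoInDistribution_collab (h : IsGaussianData S σ x ξ P) (hS : S.PosDef) (hσ : 0 < σ)
    (hC : IsUnit (V.precision S σ θ)) {est : ℕ → Ω → EuclideanSpace ℝ (Fin d)}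
    (hm : ∀ n, AEMeasurable (est n) P)
    (hest : ∀ n, ∀ᵐ ω ∂P, V.IsCollab S (fun i k => x n i k ω)
      (fun i k => inner ℝ (x n i k ω) θ + ξ n i k ω) (est n ω)) :
    TendstoInDistribution (fun (n : ℕ) ω => √(n : ℝ) • (est n ω - θ)) atTop id (fun _ => P)
      (multivariateGaussian 0 (V.covG S σ θ)) := by
  have hlinear := tendstoInDistribution_euclMul (V.precision_posSemidef hS hσ θ) (V.covG S σ θ)
    (h.tendstoInDistribution_totalScore V hS hσ θ)
  have hsymm : (V.covG S σ θ)ᵀ = V.covG S σ θ := by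
    simpa [IsHermitian] using (V.covG_posSemidef hS hσ θ).isHermitian
  rw [hsymm, Matrix.mul_assoc, V.precision_mul_covG hC, Matrix.mul_one] at hlinear
  have hmeas (n : ℕ) : AEMeasurable (fun ω => √(n : ℝ) • (est n ω - θ)) P :=
    ((hm n).sub_const θ).const_smul √(n : ℝ)
  have hbound := h.integral_sum_norm_score_sq_le V hS hσ θ
  refine tendstoInDistribution_of_tendstoInMeasure_sub _ _ hlinear
    (tendstoInMeasure_zero_of_ae_tendsto_div
      (fun n => (hmeas n).sub (hlinear.forall_aemeasurable n))
      (fun n ω => Finset.sum_nonneg fun i _ => sq_nonneg _)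
      (fun n => (hbound n).1) (fun n => (hbound n).2) ?_) hmeas
  filter_upwards [ae_all_iff.2 (h.ae_tendsto_agentGram V hS), ae_all_iff.2
    (h.ae_tendsto_score V hS θ), ae_all_iff.2 (h.ae_tendsto_mean_noise_sq V hS hσ θ),
    ae_all_iff.2 hest] with ω hgram hscore hnoise hcollab
  exact V.tendsto_norm_sqrt_smul_sub_div hS hσ hC
    (z := fun n i k => (x n i k ω, ξ n i k ω)) hgram hscore hnoise hcollab

end IsGaussianData

theorem mainTheorem1 {m d : ℕ} (V : Views m d) (S : Matrix (Fin d) (Fin d) ℝ) (hS : S.PosDef)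
    (σ : ℝ) (hσ : 0 < σ) (θ : EuclideanSpace ℝ (Fin d)) (hC : IsUnit (V.precision S σ θ))
    {Ω : Type*} [MeasurableSpace Ω] (P : Measure Ω) [IsProbabilityMeasure P]
    (X : (n : ℕ) → (i : Fin m) → Fin n → Ω → EuclideanSpace ℝ (Fin (V.obs i)))
    (hX : V.IsGaussianDesign S X P) :
    -- full-feature lower bound
    (∀ u : EuclideanSpace ℝ (Fin d), ∀ᵐ ω ∂P,
      ENNReal.ofReal (u.ofLp ⬝ᵥ V.covG S σ θ *ᵥ u.ofLp) ≤
        liminf (fun c : ℝ => liminf (fun n : ℕ =>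
          V.minimaxRisk S σ θ (fun i k => X n i k ω) id c u) atTop) atTop) ∧
    -- missing-feature lower bound
    (∀ (i : Fin m) (u : EuclideanSpace ℝ (Fin (V.obs i))), ∀ᵐ ω ∂P,
      ENNReal.ofReal
          (u.ofLp ⬝ᵥ (V.transfer S i * V.covG S σ θ * (V.transfer S i)ᵀ) *ᵥ u.ofLp) ≤
        liminf (fun c : ℝ => liminf (fun n : ℕ =>
          V.minimaxRisk S σ θ (fun j k => X n j k ω) (euclMul (V.transfer S i)) c u)
            atTop) atTop) ∧
    -- the Collab estimators are asymptotically normal with exactly these covariances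
    (∀ {Ω' : Type*} [MeasurableSpace Ω'] (P' : Measure Ω') [IsProbabilityMeasure P']
      (x : (n : ℕ) → Fin m → Fin n → Ω' → EuclideanSpace ℝ (Fin d))
      (ξ : (n : ℕ) → Fin m → Fin n → Ω' → ℝ) (_ : IsGaussianData S σ x ξ P')
      (est : ℕ → Ω' → EuclideanSpace ℝ (Fin d)) (_ : ∀ n, AEMeasurable (est n) P')
      (_ : ∀ n, ∀ᵐ ω ∂P', V.IsCollab S (fun i k => x n i k ω)
        (fun i k => inner ℝ (x n i k ω) θ + ξ n i k ω) (est n ω)),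
      TendstoInDistribution (fun (n : ℕ) ω => √(n : ℝ) • (est n ω - θ)) atTop id (fun _ => P')
        (multivariateGaussian 0 (V.covG S σ θ)) ∧
      ∀ i, TendstoInDistribution
        (fun (n : ℕ) ω => √(n : ℝ) • (euclMul (V.transfer S i) (est n ω) - euclMul (V.transfer S i) θ))
        atTop id (fun _ => P')
        (multivariateGaussian 0 (V.transfer S i * V.covG S σ θ * (V.transfer S i)ᵀ))) := by
  have hgram := Views.IsGaussianDesign.ae_tendsto_designGram V hS hX
  refine ⟨fun u => ?_, fun i u => ?_, fun P' _ x ξ hdata est hm hest => ?_⟩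
  · filter_upwards [hgram] with ω hω
    exact V.ofReal_covG_le_liminf_minimaxRisk hS hσ hC hω fun _ => rfl
  · filter_upwards [hgram] with ω hω
    have h := V.ofReal_covG_le_liminf_minimaxRisk hS hσ hC hω
      (ψ := euclMul (V.transfer S i)) (u := u) (u' := euclMul (V.transfer S i)ᵀ u) fun ϑ => by
        rw [inner_euclMul, transpose_transpose]
    rw [← mulVec_mulVec, ← mulVec_mulVec, dotProduct_mulVec, ← mulVec_transpose]
    exact h
  · have h := hdata.tendstoInDistribution_collab V hS hσ hC hm hest
    refine ⟨h, fun i => ?_⟩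
    simpa only [euclMul_smul, euclMul_sub] using
      tendstoInDistribution_euclMul (V.covG_posSemidef hS hσ θ) (V.transfer S i) h
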